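/- **Setting.** There are $n$ bidders with private values $v=(v_1,\dots,v_n)$ and predictions $\hat v=(\hat v_1,\dots,\hat v_n)$, both non-negative real vectors; any set of bidders can be served (digital goods). Write $v_{(1)}\ge v_{(2)}\ge\dots\ge v_{(n)}$ for the sorted values. The benchmarks are $$OPT(v)=\sum_{i=1}^n v_i,\qquad \mathcal F^{(2)}(v)=\max_{2\le k\le n}k\,v_{(k)},\qquad \mathrm{maxV}(v)=\max_{1\le k<n}k\,v_{(k+1)},$$ where an empty maximum is $0$. An offline mechanism $\mathcal M$ gives, for every $n$ and $\hat v$, a probability distribution over deterministic sealed-bid auctions for $n$ bidders (payments are non-negative, a served bidder pays at most its bid, a bidder who is not served pays $0$). It is *truthful* if it is a distribution over auctions in which reporting one's true value is a dominant strategy. An online mechanism offers to each arriving bidder an irrevocable (possibly random) price that depends only on the bids of the earlier bidders and the predictions revealed so far; the bidder buys if and only if the price is at most its bid. It is *truthful* if, for every order of arrival and every realization of the random seed, reporting one's true value is a dominant strategy. The revenue of an online mechanism is its expected revenue over a uniformly random order of arrival and its own randomness. Writing $\mathcal M^{\hat v}(v)$ for the expected revenue with predictions $\hat v$ and truthfully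 reported values $v$, a mechanism is *$c$-consistent* against $f$ if $\mathcal M^{\hat v}(\hat v)\ge f(\hat v)/c$ for all $n,\hat v$, and *$\alpha$-robust* against $f$ if $\mathcal M^{\hat v}(v)\ge f(v)/\alpha$ for all $n,\hat v,v$. Given a truthful offline mechanism $\mathcal M$, the *Online Sampling Auction with Predictions* $\mathrm{OSAP}(\mathcal M)$ offers to the first bidder its predicted value, and to the $t$-th arriving bidder, $t\ge2$, the price that $\mathcal M$, run on the $t$ arrived bidders (listed in order of arrival) with their predictions, offers to that bidder, i.e. the infimum of the bids with which $\mathcal M$ would serve it given the $t-1$ earlier bids. **Theorem.** 1. There is a truthful offline mechanism $\mathcal M$ that is $1$-consistent against $OPT$ and $4.42$-robust against $\mathcal F^{(2)}$, and such that the online mechanism $\mathrm{OSAP}(\mathcal M)$ is truthful, $1$-consistent against $OPT$ and $8.84$-robust against $\mathcal F^{(2)}$. 2. There is a truthful offline mechanism $\mathcal M$ that is $1$-consistent against $OPT$ and $(e+1)$-robust against $\mathrm{maxV}$, and such that the online mechanism $\mathrm{OSAP}(\mathcal M)$ is truthful, $1$-consistent against $OPT$ and $2(e+1)$-robust against $\mathrm{maxV}$.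 -/

import Mathlib

open MeasureTheory
open scoped NNReal ENNReal

noncomputable section

namespace CompetitiveAuction

/-! ### Benchmarks -/

/-- A revenue benchmark: a function of the value vector, for every number `n` of bidders. -/
abbrev Benchmark : Type := (n : ℕ) → (Fin n → ℝ≥0) → ℝ≥0

/-- The values in non-increasing order: `sortedDesc v j` is the `(j + 1)`-st largest value. -/
def sortedDesc {n : ℕ} (v : Fin n → ℝ≥0) (j : Fin n) : ℝ≥0 :=
  v (Tuple.sort v (Fin.rev j))

/-- The optimal revenue when any set of bidders can be served: the sum of all values. -/
def OPT : Benchmark := fun _ v => ∑ i, v i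

/-- `F⁽²⁾(v) = max_{2 ≤ k ≤ n} k * v_k`, where `v_k` is the `k`-th largest value
(here `k = j + 1`); it is `0` if `n ≤ 1`. -/
def F2 : Benchmark := fun n v =>
  (Finset.univ.filter fun j : Fin n => 2 ≤ (j : ℕ) + 1).sup
    fun j => ((j : ℕ) + 1 : ℝ≥0) * sortedDesc v j

/-- `maxV(v) = max_{k < n} k * v_{k+1}`, where `v_{k+1}` is the `(k + 1)`-st largest value; it is `0`
if `n ≤ 1`. -/
def maxV : Benchmark := fun n v =>
  Finset.univ.sup fun k : Fin n => ((k : ℕ) : ℝ≥0) * sortedDesc v k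

/-- Given the expected revenue `rev n vhat v` of a mechanism on `n` bidders with predictions `vhat`
and values `v`: the mechanism is `c`-consistent against `f`. -/
def IsConsistent (rev : (n : ℕ) → (Fin n → ℝ≥0) → (Fin n → ℝ≥0) → ℝ) (c : ℝ)
    (f : Benchmark) : Prop :=
  ∀ (n : ℕ) (vhat : Fin n → ℝ≥0), (f n vhat : ℝ) / c ≤ rev n vhat vhat

/-- The mechanism is `α`-robust against `f`, whatever the predictions are. -/
def IsRobust (rev : (n : ℕ) → (Fin n → ℝ≥0) → (Fin n → ℝ≥0) → ℝ) (α : ℝ)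
    (f : Benchmark) : Prop :=
  ∀ (n : ℕ) (vhat v : Fin n → ℝ≥0), (f n v : ℝ) / α ≤ rev n vhat v

/-! ### Offline digital good auctions -/

/-- A deterministic sealed-bid auction with `n` bidders and no feasibility constraint. Payments are
non-negative, a served bidder pays at most its bid, and a bidder who is not served pays nothing. -/
structure DetAuction (n : ℕ) where
  /-- `Serves b i`: bidder `i` is served when the bid vector is `b`. -/
  Serves : (Fin n → ℝ≥0) → Fin n → Prop
  pay : (Fin n → ℝ≥0) → Fin n → ℝ≥0
  pay_le : ∀ b i, Serves b i → pay b i ≤ b i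
  pay_eq_zero : ∀ b i, ¬ Serves b i → pay b i = 0

namespace DetAuction

variable {n : ℕ}

open Classical in
/-- The utility of bidder `i` with value `x` when the bid vector is `b`. -/
def utility (D : DetAuction n) (b : Fin n → ℝ≥0) (i : Fin n) (x : ℝ≥0) : ℝ :=
  if D.Serves b i then (x : ℝ) - D.pay b i else 0

/-- Reporting the true value is a dominant strategy for every bidder. -/
def Truthful (D : DetAuction n) : Prop :=
  ∀ (b : Fin n → ℝ≥0) (i : Fin n) (z : ℝ≥0),
    D.utility (Function.update b i z) i (b i) ≤ D.utility b i (b i)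

/-- The price that the auction offers to bidder `i`, as a function of the other bids: the infimum
of the bids with which `i` is served (`∞` if there is none). It does not depend on `b i`. -/
def price (D : DetAuction n) (b : Fin n → ℝ≥0) (i : Fin n) : ℝ≥0∞ :=
  ⨅ (z : ℝ≥0) (_ : D.Serves (Function.update b i z) i), (z : ℝ≥0∞)

end DetAuction

/-- A randomized learning-augmented mechanism for digital good auctions: for every number of bidders
and every prediction vector, a distribution of deterministic auctions. -/
structure Mechanism where
  Ω : Type
  [mΩ : MeasurableSpace Ω]
  μ : Measure Ω
  [prob : IsProbabilityMeasure μ]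
  /-- `auction n vhat ω`: the auction run on `n` bidders with predictions `vhat`
  for the random seed `ω`. -/
  auction : (n : ℕ) → (Fin n → ℝ≥0) → Ω → DetAuction n
  measurableSet_serves : ∀ (n : ℕ) (vhat b : Fin n → ℝ≥0) (i : Fin n),
    MeasurableSet {ω | (auction n vhat ω).Serves b i}
  measurable_pay : ∀ (n : ℕ) (vhat b : Fin n → ℝ≥0) (i : Fin n),
    Measurable fun ω => (auction n vhat ω).pay b i

attribute [instance] Mechanism.mΩ Mechanism.prob

namespace Mechanism

/-- A randomized mechanism is truthful if it is a distribution of truthful auctions. -/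
def Truthful (M : Mechanism) : Prop :=
  ∀ (n : ℕ) (vhat : Fin n → ℝ≥0) (ω : M.Ω), (M.auction n vhat ω).Truthful

/-- The expected revenue for predictions `vhat` and (truthfully reported) values `v`. -/
def revenue (M : Mechanism) (n : ℕ) (vhat v : Fin n → ℝ≥0) : ℝ :=
  ∫ ω, ∑ i, ((M.auction n vhat ω).pay v i : ℝ) ∂M.μ

end Mechanism

/-! ### Online auctions -/

/-- A randomized learning-augmented mechanism for online auctions. The bidder who arrives after `t`
others is offered a price that depends on the `t` earlier bids (in order of arrival), on the `t + 1`
predictions revealed so far (in order of arrival) and on the random seed. -/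
structure OnlineMechanism where
  Ω : Type
  [mΩ : MeasurableSpace Ω]
  μ : Measure Ω
  [prob : IsProbabilityMeasure μ]
  /-- `price t past preds ω`; the value `∞` stands for a refusal to sell. -/
  price : (t : ℕ) → (Fin t → ℝ≥0) → (Fin (t + 1) → ℝ≥0) → Ω → ℝ≥0∞
  measurable_price : ∀ (t : ℕ) (past : Fin t → ℝ≥0) (preds : Fin (t + 1) → ℝ≥0),
    Measurable (price t past preds)

attribute [instance] OnlineMechanism.mΩ OnlineMechanism.prob

namespace OnlineMechanism

variable (A : OnlineMechanism) {n : ℕ}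

/-- The price offered to the bidder `π t`, who arrives after the bidders `π s`, `s < t`, when the
predictions are `vhat` and the bids are `b`. -/
def offer (vhat b : Fin n → ℝ≥0) (π : Equiv.Perm (Fin n)) (ω : A.Ω) (t : Fin n) : ℝ≥0∞ :=
  A.price t (fun s => b (π (Fin.castLE t.isLt.le s))) (fun s => vhat (π (Fin.castLE t.isLt s))) ω

open Classical in
/-- The payment of the bidder `π t`, who buys if and only if the price is at most its bid. -/
def pay (vhat b : Fin n → ℝ≥0) (π : Equiv.Perm (Fin n)) (ω : A.Ω) (t : Fin n) : ℝ :=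
  if A.offer vhat b π ω t ≤ b (π t) then (A.offer vhat b π ω t).toReal else 0

open Classical in
/-- The utility of the bidder `π t` with value `x` when the bids are `b`. -/
def utility (vhat b : Fin n → ℝ≥0) (π : Equiv.Perm (Fin n)) (ω : A.Ω) (t : Fin n) (x : ℝ≥0) : ℝ :=
  if A.offer vhat b π ω t ≤ b (π t) then (x : ℝ) - (A.offer vhat b π ω t).toReal else 0

/-- For every order of arrival and every random seed, reporting the true value is a dominant
strategy for every bidder. -/
def Truthful : Prop :=
  ∀ (n : ℕ) (vhat b : Fin n → ℝ≥0) (π : Equiv.Perm (Fin n)) (ω : A.Ω) (t : Fin n) (z : ℝ≥0),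
    A.utility vhat (Function.update b (π t) z) π ω t (b (π t)) ≤
      A.utility vhat b π ω t (b (π t))

/-- The expected revenue, over a uniformly random order of arrival and the random seed. -/
def revenue (n : ℕ) (vhat v : Fin n → ℝ≥0) : ℝ :=
  (∑ π : Equiv.Perm (Fin n), ∫ ω, ∑ t, A.pay vhat v π ω t ∂A.μ) / (Nat.factorial n : ℝ)

end OnlineMechanism

/-! ### The Online Sampling Auction with Predictions -/

/-- In a truthful auction a bidder who is served is also served with any higher bid. -/
theorem DetAuction.Truthful.serves_mono {n : ℕ} {D : DetAuction n} (hD : D.Truthful)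
    {b : Fin n → ℝ≥0} {i : Fin n} {x y : ℝ≥0} (hxy : x < y)
    (hx : D.Serves (Function.update b i x) i) : D.Serves (Function.update b i y) i := by
  by_contra hy
  have h1 := hD (Function.update b i y) i x
  have h2 := D.pay_le _ _ hx
  have h3 : (D.pay (Function.update b i x) i : ℝ) ≤ x := by
    have h4 : D.pay (Function.update b i x) i ≤ x := by simpa using h2
    exact_mod_cast h4
  have h5 : (x : ℝ) < y := by exact_mod_cast hxy
  simp [DetAuction.utility, hx, hy] at h1
  have h6 : (y : ℝ) ≤ D.pay (Function.update b i x) i := by exact_mod_cast h1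
  linarith

theorem Mechanism.Truthful.measurable_price {M : Mechanism} (hM : M.Truthful) (n : ℕ)
    (vhat b : Fin n → ℝ≥0) (i : Fin n) :
    Measurable fun ω => (M.auction n vhat ω).price b i := by
  refine measurable_of_Iio fun c => ?_
  obtain ⟨Q, hQ, hQd⟩ := TopologicalSpace.exists_countable_dense ℝ≥0
  have hset : (fun ω => (M.auction n vhat ω).price b i) ⁻¹' Set.Iio c =
      ⋃ q ∈ Q, {ω | (q : ℝ≥0∞) < c ∧ (M.auction n vhat ω).Serves (Function.update b i q) i} := by
    ext ω
    simp only [Set.mem_preimage, Set.mem_Iio, DetAuction.price, iInf_lt_iff, Set.mem_iUnion,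
      Set.mem_ofPred_eq, exists_prop]
    constructor
    · rintro ⟨z, hz, hzc⟩
      obtain ⟨y, hzy, hyc⟩ := ENNReal.lt_iff_exists_nnreal_btwn.1 hzc
      obtain ⟨q, hq, hqQ⟩ := hQd.exists_between (ENNReal.coe_lt_coe.1 hzy)
      exact ⟨q, hq, (ENNReal.coe_lt_coe.2 hqQ.2).trans hyc,
        (hM n vhat ω).serves_mono hqQ.1 hz⟩
    · rintro ⟨q, -, hqc, hq⟩
      exact ⟨q, hq, hqc⟩
  rw [hset]
  refine MeasurableSet.biUnion hQ fun q _ => ?_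
  by_cases hqc : (q : ℝ≥0∞) < c
  · simpa [hqc] using M.measurableSet_serves n vhat (Function.update b i q) i
  · simp [hqc]

/-- The Online Sampling Auction with Predictions: the first bidder is offered its predicted value;
a bidder who arrives after `t ≥ 1` others is offered the price that the offline mechanism, run on
the `t + 1` arrived bidders and their predictions, offers to it. -/
def OSAP (M : Mechanism) (hM : M.Truthful) : OnlineMechanism where
  Ω := M.Ω
  μ := M.μ
  price t past preds ω :=
    if t = 0 then (preds (Fin.last t) : ℝ≥0∞)
    else (M.auction (t + 1) preds ω).price (Fin.snoc (α := fun _ => ℝ≥0) past 0) (Fin.last t)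
  measurable_price t past preds := by
    by_cases ht : t = 0
    · simp [ht]
    · simpa [ht] using hM.measurable_price (t + 1) preds
        (Fin.snoc (α := fun _ => ℝ≥0) past 0) (Fin.last t)

end CompetitiveAuction

end

/-! Both mechanisms let each bidder look at the mistakes, i.e. at those other bidders whose bids
differ from their predictions. A bidder who sees no mistake is offered its prediction, so correct
predictions give the revenue `OPT`. A bidder who sees mistakes is offered a mixture of its
prediction, the highest other bid and the price of a random sampling auction. No price depends on
the bidder's own bid, which gives truthfulness.

The sampling auction colours the bidders at random with `m` colours and tries to extract from each
colour the best single-price revenue of the other colours. It succeeds at the colour with the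
largest such revenue, so it earns at least the second largest one. If `S` is a set of bidders with
values at least `c`, this is `c` times the second largest number of bidders of `S` in a colour, a
balls-in-bins quantity. Potential functions show that it is on average at least `3 (|S| - 1) / 8`
for two colours and `50 |S| / 171` for three.

Robustness weighs two regimes. With many mistakes everybody sees some, and sampling earns enough by
itself. With few mistakes almost all bidders of `S` are predicted correctly and pay their
predictions with a fixed probability. For `maxV` the benchmark already forgives one bidder, and the
weights 3 and 8 give the ratio 11/3 < e + 1 (`maxVRule_isRobust`). For `F2` the weights 50 and 171
give 221/50 = 4.42, but one or two mistaken bidders of `S` must be made up for by second-price and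
sampling payments (`fTwoRule_revenue_ge`).

Online, the last of the arrived bidders is a uniformly random one of them, so it pays on average an
equal part of the offline revenue from the arrived set. Charging this to the bidders of `S` yields
the same amount for each of them but the first to arrive (`MixRule.online_revenue_ge`). Losing that
one costs at most a factor of two. -/

noncomputable section

namespace CompetitiveAuction

open Finset

/-! ### Numbers of balls in random bins -/

/-- The operator on functions of the occupation numbers of `m` bins that adds a ball to bin `a`. -/
def addBall {m : ℕ} (a : Fin m) : Module.End ℕ ((Fin m → ℕ) → ℕ) where
  toFun G N := G (N + Pi.single a 1)
  map_add' _ _ := rfl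
  map_smul' _ _ := rfl

/-- The sum of `G` over all ways to throw `k` more balls into `m` bins occupied according to `N`. -/
def throwSum {m : ℕ} (k : ℕ) (G : (Fin m → ℕ) → ℕ) : (Fin m → ℕ) → ℕ :=
  ((∑ a, addBall a) ^ k : Module.End ℕ ((Fin m → ℕ) → ℕ)) G

theorem throwSum_zero {m : ℕ} (G : (Fin m → ℕ) → ℕ) : throwSum 0 G = G := rfl

theorem throwSum_succ {m : ℕ} (k : ℕ) (G : (Fin m → ℕ) → ℕ) (N : Fin m → ℕ) :
    throwSum (k + 1) G N = ∑ a, throwSum k G (N + Pi.single a 1) := by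
  simp [throwSum, pow_succ', addBall, LinearMap.sum_apply, Finset.sum_apply]

theorem throwSum_add {m : ℕ} (k l : ℕ) (G : (Fin m → ℕ) → ℕ) :
    throwSum (k + l) G = throwSum k (throwSum l G) := by
  simp [throwSum, pow_add]

theorem addBall_pow_apply {m : ℕ} (a : Fin m) (k : ℕ) (G : (Fin m → ℕ) → ℕ) (N : Fin m → ℕ) :
    (addBall a ^ k) G N = G (N + Pi.single a k) := by
  induction k generalizing N with
  | zero => simp
  | succ k ih =>
    rw [pow_succ', Module.End.mul_apply]
    change ((addBall a ^ k) G) (N + Pi.single a 1) = _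
    rw [ih, add_assoc, ← Pi.single_add, add_comm 1 k]

/-- Commutativity makes the binomial theorem available for `(∑ a, addBall a) ^ k`. It groups the
throws by occupation numbers, so that the small cases can be evaluated. -/
theorem addBall_commute {m : ℕ} (a b : Fin m) : Commute (addBall a) (addBall b) := by
  refine LinearMap.ext fun G => funext fun N => ?_
  change G (N + Pi.single a 1 + Pi.single b 1) = G (N + Pi.single b 1 + Pi.single a 1)
  rw [add_right_comm]

theorem throwSum_two (k : ℕ) (G : (Fin 2 → ℕ) → ℕ) :
    throwSum k G 0 = ∑ i ∈ range (k + 1), k.choose i * G ![i, k - i] := by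
  rw [throwSum, Fin.sum_univ_two, (addBall_commute 0 1).add_pow, LinearMap.sum_apply,
    Finset.sum_apply]
  refine Finset.sum_congr rfl fun i _ => ?_
  rw [← (Nat.cast_commute _ _).eq, ← nsmul_eq_mul, LinearMap.smul_apply, Pi.smul_apply, smul_eq_mul,
    Module.End.mul_apply, addBall_pow_apply, addBall_pow_apply]
  congr 2
  ext j
  fin_cases j <;> simp

theorem throwSum_three (k : ℕ) (G : (Fin 3 → ℕ) → ℕ) :
    throwSum k G 0 = ∑ i ∈ range (k + 1), k.choose i *
      ∑ j ∈ range (k - i + 1), (k - i).choose j * G ![i, j, k - i - j] := by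
  rw [throwSum, Fin.sum_univ_three, add_assoc,
    ((addBall_commute 0 1).add_right (addBall_commute 0 2)).add_pow, LinearMap.sum_apply,
    Finset.sum_apply]
  refine Finset.sum_congr rfl fun i _ => ?_
  rw [← (Nat.cast_commute _ _).eq, ← nsmul_eq_mul, LinearMap.smul_apply, Pi.smul_apply, smul_eq_mul,
    Module.End.mul_apply, addBall_pow_apply, (addBall_commute 1 2).add_pow, LinearMap.sum_apply,
    Finset.sum_apply]
  congr 1
  refine Finset.sum_congr rfl fun j _ => ?_
  rw [← (Nat.cast_commute _ _).eq, ← nsmul_eq_mul, LinearMap.smul_apply, Pi.smul_apply, smul_eq_mul,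
    Module.End.mul_apply, addBall_pow_apply, addBall_pow_apply]
  congr 2
  ext l
  fin_cases l <;> simp

/-- A potential that is dominated by `A * G` and grows on average by at least `B` per ball bounds
the average of `A * G` from below. -/
theorem throwSum_ge_of_potential {m : ℕ} {G : (Fin m → ℕ) → ℕ} {A B : ℤ} (M : (Fin m → ℕ) → ℤ)
    (hM : ∀ N, M N ≤ A * G N)
    (hdrift : ∀ N, (m : ℤ) * (M N + B) ≤ ∑ a, M (N + Pi.single a 1)) (k : ℕ) (N : Fin m → ℕ) :
    (m : ℤ) ^ k * (M N + B * k) ≤ A * throwSum k G N := by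
  induction k generalizing N with
  | zero => simpa [throwSum_zero] using hM N
  | succ k ih =>
    rw [throwSum_succ]
    push_cast
    rw [Finset.mul_sum]
    refine le_trans ?_ (Finset.sum_le_sum fun a _ => ih (N + Pi.single a 1))
    rw [← Finset.mul_sum, pow_succ, mul_assoc, Finset.sum_add_distrib]
    refine mul_le_mul_of_nonneg_left ?_ (by positivity)
    have h := hdrift N
    simp only [Finset.sum_const, Finset.card_univ, Fintype.card_fin, nsmul_eq_mul]
    nlinarith [h]

/-! ### Two and three bins -/

/-- The potential for two bins whose occupation numbers differ by `d`. -/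
def potTwo (d : ℕ) : ℤ := if d = 0 then -4 else if d = 1 then -1 else 0

/-- The potential for three bins whose largest occupation numbers differ by `d`. -/
def potThree (d : ℕ) : ℤ :=
  if d = 0 then -174 else if d = 1 then -99 else if d = 2 then -45 else if d = 3 then -12 else 0

def minTwo (N : Fin 2 → ℕ) : ℕ := min (N 0) (N 1)

/-- The second largest of three numbers. -/
def med (x y z : ℕ) : ℕ := max (min x y) (min (max x y) z)

def medThree (N : Fin 3 → ℕ) : ℕ := med (N 0) (N 1) (N 2)

/-- The second fullest bin grows at different rates depending on the gap to the fullest one. The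
correction `potThree` stores the gain of a wide gap to pay for the slow growth near a tie. -/
def medPot (x y z : ℕ) : ℤ := 171 * med x y z + potThree (max x (max y z) - med x y z)

theorem medPot_comm_left (x y z : ℕ) : medPot y x z = medPot x y z := by
  have h : med y x z = med x y z := by unfold med; omega
  have h' : max y (max x z) = max x (max y z) := by omega
  rw [medPot, medPot, h, h']

theorem medPot_comm_right (x y z : ℕ) : medPot x z y = medPot x y z := by
  have h : med x z y = med x y z := by unfold med; omega
  have h' : max x (max z y) = max x (max y z) := by omega
  rw [medPot, medPot, h, h']

theorem medPot_of_le {x y z : ℕ} (hxy : y ≤ x) (hyz : z ≤ y) :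
    medPot x y z = 171 * y + potThree (x - y) := by
  have h : med x y z = y := by unfold med; omega
  have h' : max x (max y z) = x := by omega
  rw [medPot, h, h']

/-- When the smallest bin is strictly below the other two, the values of `potThree` make the mean
gain exactly 50 at the gaps 0, 1, 2, 3. At gap 4 it is 53, and beyond it is 171 / 3 = 57. A tie of
the two smaller bins only helps. -/
theorem medPot_drift_of_le {x y z : ℕ} (hxy : y ≤ x) (hyz : z ≤ y) :
    3 * (medPot x y z + 50) ≤
      medPot (x + 1) y z + medPot x (y + 1) z + medPot x y (z + 1) := by
  rw [medPot_of_le hxy hyz, medPot_of_le (by omega : y ≤ x + 1) hyz]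
  have h2 : medPot x (y + 1) z = if y < x then 171 * ((y + 1 : ℕ) : ℤ) + potThree (x - (y + 1))
      else 171 * x + potThree (y + 1 - x) := by
    split_ifs with h
    · rw [medPot_of_le (by omega) (by omega)]
    · rw [medPot_comm_left, medPot_of_le (by omega) (by omega)]
  have h3 : medPot x y (z + 1) = if z < y then 171 * (y : ℤ) + potThree (x - y)
      else if y < x then 171 * ((z + 1 : ℕ) : ℤ) + potThree (x - (z + 1))
      else 171 * x + potThree (z + 1 - x) := by
    split_ifs with h h'
    · rw [medPot_of_le (by omega) (by omega)]
    · rw [medPot_comm_right, medPot_of_le (by omega) (by omega)]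
    · rw [medPot_comm_right, medPot_comm_left, medPot_of_le (by omega) (by omega)]
  rw [h2, h3]
  obtain ⟨d, rfl⟩ := Nat.exists_eq_add_of_le hxy
  obtain ⟨e, rfl⟩ := Nat.exists_eq_add_of_le hyz
  unfold potThree
  rcases Nat.eq_zero_or_pos e with rfl | he
  · rcases d with _ | _ | _ | _ | _ | d
    all_goals simp
    all_goals try split_ifs
    all_goals omega
  · rcases d with _ | _ | _ | _ | _ | d
    all_goals simp [he]
    all_goals try split_ifs
    all_goals omega

theorem medPot_drift (x y z : ℕ) :
    3 * (medPot x y z + 50) ≤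
      medPot (x + 1) y z + medPot x (y + 1) z + medPot x y (z + 1) := by
  rcases le_total y x with h1 | h1 <;> rcases le_total z y with h2 | h2 <;>
    rcases le_total z x with h3 | h3
  · exact medPot_drift_of_le h1 h2
  · exact medPot_drift_of_le h1 h2
  · have := medPot_drift_of_le h3 h2
    simp only [medPot_comm_right x] at this ⊢
    rw [medPot_comm_right (x + 1)] at this
    linarith
  · have := medPot_drift_of_le h3 h1
    rw [medPot_comm_left x z y, medPot_comm_right x y z, medPot_comm_left x (z + 1) y,
      medPot_comm_right x y (z + 1), medPot_comm_left (x + 1) z y, medPot_comm_right (x + 1) y z,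
      medPot_comm_left x z (y + 1), medPot_comm_right x (y + 1) z] at this
    linarith
  · have := medPot_drift_of_le h1 h3
    rw [medPot_comm_left x y z, medPot_comm_left x (y + 1) z, medPot_comm_left (x + 1) y z,
      medPot_comm_left x y (z + 1)] at this
    linarith
  · have := medPot_drift_of_le h2 h3
    rw [medPot_comm_right y x z, medPot_comm_left x y z, medPot_comm_right (y + 1) x z,
      medPot_comm_left x (y + 1) z, medPot_comm_right y x (z + 1), medPot_comm_left x y (z + 1),
      medPot_comm_right y (x + 1) z, medPot_comm_left (x + 1) y z] at this
    linarith
  · have := medPot_drift_of_le h2 h1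
    rw [medPot_comm_left y z x, medPot_comm_right y x z, medPot_comm_left x y z,
      medPot_comm_left y (z + 1) x, medPot_comm_right y x (z + 1), medPot_comm_left x y (z + 1),
      medPot_comm_left (y + 1) z x, medPot_comm_right (y + 1) x z, medPot_comm_left x (y + 1) z,
      medPot_comm_left y z (x + 1), medPot_comm_right y (x + 1) z, medPot_comm_left (x + 1) y z]
      at this
    linarith
  · have := medPot_drift_of_le h2 h1
    rw [medPot_comm_left y z x, medPot_comm_right y x z, medPot_comm_left x y z,
      medPot_comm_left y (z + 1) x, medPot_comm_right y x (z + 1), medPot_comm_left x y (z + 1),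
      medPot_comm_left (y + 1) z x, medPot_comm_right (y + 1) x z, medPot_comm_left x (y + 1) z,
      medPot_comm_left y z (x + 1), medPot_comm_right y (x + 1) z, medPot_comm_left (x + 1) y z]
      at this
    linarith

theorem throwSum_medThree_ge_potential (k : ℕ) (N : Fin 3 → ℕ) :
    (3 : ℤ) ^ k * (medPot (N 0) (N 1) (N 2) + 50 * k) ≤ 171 * throwSum k medThree N := by
  refine throwSum_ge_of_potential (m := 3) (fun N => medPot (N 0) (N 1) (N 2)) (fun N => ?_)
    (fun N => ?_) k N
  · have : potThree (max (N 0) (max (N 1) (N 2)) - med (N 0) (N 1) (N 2)) ≤ 0 := by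
      unfold potThree; split_ifs <;> simp
    simp only [medPot, medThree]
    linarith
  · have h := medPot_drift (N 0) (N 1) (N 2)
    rw [Fin.sum_univ_three]
    simpa using h

/-- The mean gain is exactly 3 at the differences 0 and 1, it is 7/2 at the difference 2, and 8 / 2
= 4 beyond. -/
theorem throwSum_minTwo_ge_potential (k : ℕ) (N : Fin 2 → ℕ) :
    (2 : ℤ) ^ k * (8 * minTwo N + potTwo (max (N 0) (N 1) - minTwo N) + 3 * k) ≤
      8 * throwSum k minTwo N := by
  refine throwSum_ge_of_potential (m := 2)
    (fun N => 8 * minTwo N + potTwo (max (N 0) (N 1) - minTwo N)) (fun N => ?_) (fun N => ?_) k N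
  · have : potTwo (max (N 0) (N 1) - minTwo N) ≤ 0 := by
      unfold potTwo; split_ifs <;> simp
    linarith
  · rw [Fin.sum_univ_two]
    simp only [minTwo, potTwo, Pi.add_apply, Pi.single_eq_same]
    simp only [Pi.single_apply]
    simp only [Fin.isValue, one_ne_zero, zero_ne_one, if_false, add_zero]
    push_cast
    split_ifs <;> omega

/-- The second largest of three bins with `k ≥ 2` balls holds `50 k / 171` balls on average. -/
theorem throwSum_medThree_ge {k : ℕ} (hk : 2 ≤ k) :
    50 * k * 3 ^ k ≤ 171 * throwSum k medThree 0 := by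
  -- The potential starts at -174, so the drift from the empty bins alone is not enough. After 13
  -- balls its mean is at least 650 = 50 * 13, and the drift takes over; fewer balls are checked by
  -- evaluation.
  rcases lt_or_ge k 13 with h | h
  · rw [throwSum_three]
    interval_cases k <;> decide +kernel
  · obtain ⟨l, rfl⟩ := Nat.exists_eq_add_of_le h
    rw [throwSum_add, throwSum_three]
    have key : ∀ x y z, (3 : ℤ) ^ l * (medPot x y z + 50 * l) ≤
        171 * throwSum l medThree ![x, y, z] := fun x y z =>
      throwSum_medThree_ge_potential l ![x, y, z]
    have hsum : (3 : ℤ) ^ l * ∑ i ∈ range (13 + 1), (Nat.choose 13 i : ℤ) *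
        ∑ j ∈ range (13 - i + 1), ((13 - i).choose j : ℤ) *
          (medPot i j (13 - i - j) + 50 * l) ≤
        171 * ∑ i ∈ range (13 + 1), (Nat.choose 13 i : ℤ) *
        ∑ j ∈ range (13 - i + 1), ((13 - i).choose j : ℤ) *
          throwSum l medThree ![i, j, 13 - i - j] := by
      rw [Finset.mul_sum, Finset.mul_sum]
      refine Finset.sum_le_sum fun i _ => ?_
      rw [mul_left_comm, mul_left_comm (171 : ℤ)]
      refine mul_le_mul_of_nonneg_left ?_ (by positivity)
      rw [Finset.mul_sum, Finset.mul_sum]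
      refine Finset.sum_le_sum fun j _ => ?_
      rw [mul_left_comm, mul_left_comm (171 : ℤ)]
      exact mul_le_mul_of_nonneg_left (key _ _ _) (by positivity)
    have hval : ∑ i ∈ range (13 + 1), (Nat.choose 13 i : ℤ) *
        ∑ j ∈ range (13 - i + 1), ((13 - i).choose j : ℤ) *
          (medPot i j (13 - i - j) + 50 * l) =
        (∑ i ∈ range (13 + 1), (Nat.choose 13 i : ℤ) *
        ∑ j ∈ range (13 - i + 1), ((13 - i).choose j : ℤ) * medPot i j (13 - i - j)) +
        (∑ i ∈ range (13 + 1), (Nat.choose 13 i : ℤ) *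
        ∑ j ∈ range (13 - i + 1), ((13 - i).choose j : ℤ)) * (50 * l) := by
      simp only [mul_add, Finset.sum_add_distrib, Finset.sum_mul, Finset.mul_sum, mul_assoc]
    have hpot : (3 : ℤ) ^ 13 * 650 ≤ ∑ i ∈ range (13 + 1), (Nat.choose 13 i : ℤ) *
        ∑ j ∈ range (13 - i + 1), ((13 - i).choose j : ℤ) * medPot i j (13 - i - j) := by
      decide +kernel
    have hone : ∑ i ∈ range (13 + 1), (Nat.choose 13 i : ℤ) *
        ∑ j ∈ range (13 - i + 1), ((13 - i).choose j : ℤ) = 3 ^ 13 := by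
      decide +kernel
    rw [hval, hone] at hsum
    zify
    have h3 : (0 : ℤ) < 3 ^ l := by positivity
    have := mul_le_mul_of_nonneg_left hpot h3.le
    refine le_trans ?_ hsum
    rw [pow_add]
    nlinarith

/-- The smaller of two bins with `k ≥ 2` balls holds at least `3 (k - 1) / 8` balls on average. -/
theorem throwSum_minTwo_ge {k : ℕ} (hk : 2 ≤ k) :
    3 * (k - 1) * 2 ^ k ≤ 8 * throwSum k minTwo 0 := by
  -- After 6 balls the mean potential is 976 / 64 = 15.25, above the required 15 = 3 * (6 - 1).
  rcases lt_or_ge k 6 with h | h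
  · rw [throwSum_two]
    interval_cases k <;> decide +kernel
  · obtain ⟨l, rfl⟩ := Nat.exists_eq_add_of_le h
    rw [throwSum_add, throwSum_two]
    have key : ∀ x y, (2 : ℤ) ^ l * (8 * minTwo ![x, y] + potTwo (max x y - minTwo ![x, y]) +
        3 * l) ≤ 8 * throwSum l minTwo ![x, y] := fun x y =>
      throwSum_minTwo_ge_potential l ![x, y]
    simp only [Finset.sum_range_succ, Finset.sum_range_zero, Nat.choose]
    have h0 := key 0 6
    have h1 := key 1 5
    have h2 := key 2 4
    have h3 := key 3 3
    have h4 := key 4 2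
    have h5 := key 5 1
    have h6 := key 6 0
    simp [minTwo, potTwo] at h0 h1 h2 h3 h4 h5 h6
    have hp : (0 : ℤ) < 2 ^ l := by positivity
    have hsub : 6 + l - 1 = 5 + l := by omega
    rw [hsub, pow_add]
    zify
    norm_num
    nlinarith

/-! ### Random colourings -/

/-- The number of elements of `S` with colour `a`. -/
def colorCount {n m : ℕ} (S : Finset (Fin n)) (s : Fin n → Fin m) (a : Fin m) : ℕ :=
  #{i ∈ S | s i = a}

/-- The colour of `i` is uniform and independent of everything else that `Φ a s` depends on.
Formally, shifting the colour of `i` by `c` is a bijection of the colourings. -/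
theorem sum_coloring_average {n m : ℕ} [NeZero m] (i : Fin n) (Φ : Fin m → (Fin n → Fin m) → ℕ)
    (hΦ : ∀ a s b, Φ a (Function.update s i b) = Φ a s) :
    m * ∑ s : Fin n → Fin m, Φ (s i) s = ∑ a, ∑ s : Fin n → Fin m, Φ a s := by
  have hshift : ∀ c : Fin m,
      ∑ s : Fin n → Fin m, Φ (s i) s = ∑ s : Fin n → Fin m, Φ (s i + c) s := by
    intro c
    refine (Fintype.sum_bijective (fun s : Fin n → Fin m => Function.update s i (s i + c))
      ?_ _ _ fun s => ?_).symm
    · refine Function.bijective_iff_has_inverse.2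
        ⟨fun s => Function.update s i (s i - c), fun s => ?_, fun s => ?_⟩ <;> simp
    · simp [hΦ]
  calc m * ∑ s : Fin n → Fin m, Φ (s i) s
      = ∑ c : Fin m, ∑ s : Fin n → Fin m, Φ (s i + c) s := by
        rw [← Finset.sum_congr rfl fun c _ => hshift c]
        simp
    _ = ∑ s : Fin n → Fin m, ∑ a, Φ a s := by
        rw [Finset.sum_comm]
        exact Finset.sum_congr rfl fun s _ => Equiv.sum_comp (Equiv.addLeft (s i)) fun a => Φ a s
    _ = _ := Finset.sum_comm

/-- Colouring `S` at random is throwing `#S` balls into `m` bins; the powers of `m` clear the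
denominators of the two averages. In the induction the colour of the new element is the next ball.
-/
theorem sum_colorCount {n m : ℕ} [NeZero m] (G : (Fin m → ℕ) → ℕ) (S : Finset (Fin n))
    (N : Fin m → ℕ) :
    m ^ #S * ∑ s : Fin n → Fin m, G (N + colorCount S s) = m ^ n * throwSum #S G N := by
  induction S using Finset.induction_on generalizing N with
  | empty =>
    have : ∀ s : Fin n → Fin m, colorCount ∅ s = 0 := fun s => by ext; simp [colorCount]
    simp [this, throwSum_zero]
  | insert i S hi ih =>
    have h1 : ∀ s : Fin n → Fin m, N + colorCount (insert i S) s =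
        N + Pi.single (s i) 1 + colorCount S s := by
      intro s
      ext a
      simp only [colorCount, Pi.add_apply, Finset.filter_insert]
      by_cases h : s i = a
      · subst h
        have : i ∉ ({j ∈ S | s j = s i} : Finset (Fin n)) := by simp [hi]
        simp [Finset.card_insert_of_notMem this]
        omega
      · simp [h]
    have h2 : ∀ (s : Fin n → Fin m) b, colorCount S (Function.update s i b) = colorCount S s := by
      intro s b
      ext a
      refine congrArg Finset.card (Finset.filter_congr fun j hj => ?_)
      rw [Function.update_of_ne (by rintro rfl; exact hi hj)]
    have h3 := sum_coloring_average i (fun a s => G (N + Pi.single a 1 + colorCount S s))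
      fun a s b => by rw [h2]
    rw [Finset.card_insert_of_notMem hi, throwSum_succ,
      Finset.sum_congr rfl fun s _ => by rw [h1 s], pow_succ, mul_assoc, h3, Finset.mul_sum, Finset.mul_sum]
    exact Finset.sum_congr rfl fun a _ => ih _

section

variable {n m : ℕ}

/-! ### Posted prices -/

open Classical in
/-- The payment of a bidder with value `x` who is offered the price `p`. -/
def postedPay (p x : ℝ≥0) : ℝ≥0 := if p ≤ x then p else 0

theorem postedPay_of_le {p x : ℝ≥0} (h : p ≤ x) : postedPay p x = p := if_pos h

theorem postedPay_of_lt {p x : ℝ≥0} (h : x < p) : postedPay p x = 0 := if_neg h.not_ge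

/-! ### The random sampling auction -/

open Classical in
/-- The optimal revenue from the bidders of colour `a` with one price for all of them. -/
def fixedRev (b : Fin n → ℝ≥0) (s : Fin n → Fin m) (a : Fin m) : ℝ≥0 :=
  univ.sup fun i => if s i = a then b i * (#{j | s j = a ∧ b i ≤ b j} : ℕ) else 0

/-- The revenue that is to be extracted from the bidders of colour `a`. -/
def target (b : Fin n → ℝ≥0) (s : Fin n → Fin m) (a : Fin m) : ℝ≥0 :=
  (univ.erase a).sup (fixedRev b s)

open Classical in
/-- The number of bidders of the colour of `i` that would share the target if `i` accepted. -/
def share (b : Fin n → ℝ≥0) (s : Fin n → Fin m) (i : Fin n) : ℕ :=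
  Nat.findGreatest
    (fun k => k ≤ #{j | j ≠ i ∧ s j = s i ∧ target b s (s i) / k ≤ b j} + 1) n

def samplePrice (b : Fin n → ℝ≥0) (s : Fin n → Fin m) (i : Fin n) : ℝ≥0 :=
  target b s (s i) / share b s i

def samplePay (b : Fin n → ℝ≥0) (s : Fin n → Fin m) (i : Fin n) : ℝ≥0 :=
  postedPay (samplePrice b s i) (b i)

theorem fixedRev_update {b : Fin n → ℝ≥0} {s : Fin n → Fin m} {i : Fin n} {a : Fin m}
    (h : s i ≠ a) (z : ℝ≥0) : fixedRev (Function.update b i z) s a = fixedRev b s a := by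
  classical
  refine Finset.sup_congr rfl fun j _ => ?_
  by_cases hj : s j = a
  · have hji : j ≠ i := by rintro rfl; exact h hj
    rw [if_pos hj, if_pos hj, Function.update_of_ne hji]
    congr 3
    refine Finset.filter_congr fun l _ => and_congr_right fun hl => ?_
    rw [Function.update_of_ne (by rintro rfl; exact h hl)]
  · rw [if_neg hj, if_neg hj]

/-- The target comes from the other colours only, and the share counts only bidders other than `i`.
-/
theorem samplePrice_update (b : Fin n → ℝ≥0) (s : Fin n → Fin m) (i : Fin n) (z : ℝ≥0) :
    samplePrice (Function.update b i z) s i = samplePrice b s i := by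
  classical
  have ht : target (Function.update b i z) s (s i) = target b s (s i) :=
    Finset.sup_congr rfl fun a ha => fixedRev_update (Finset.ne_of_mem_erase ha).symm z
  have hs : share (Function.update b i z) s i = share b s i := by
    unfold share
    congr 1
    ext k
    rw [ht]
    refine iff_of_eq (congrArg (fun t => k ≤ t + 1) (congrArg Finset.card ?_))
    refine Finset.filter_congr fun j _ => and_congr_right fun hj => ?_
    rw [Function.update_of_ne hj]
  rw [samplePrice, samplePrice, ht, hs]

theorem card_filter_comp_perm (σ : Equiv.Perm (Fin n)) (p : Fin n → Prop) [DecidablePred p] :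
    #{j | p (σ j)} = #{j | p j} := by
  rw [Finset.card_filter, Finset.card_filter]
  exact Equiv.sum_comp σ fun j => if p j then 1 else 0

theorem sup_univ_comp_perm (σ : Equiv.Perm (Fin n)) (f : Fin n → ℝ≥0) :
    (univ.sup fun i => f (σ i)) = univ.sup f := by
  conv_rhs => rw [← Finset.map_univ_equiv σ, Finset.sup_map]
  rfl

theorem fixedRev_comp_perm (σ : Equiv.Perm (Fin n)) (b : Fin n → ℝ≥0) (s : Fin n → Fin m)
    (a : Fin m) : fixedRev (b ∘ σ) (s ∘ σ) a = fixedRev b s a := by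
  classical
  unfold fixedRev
  rw [← sup_univ_comp_perm σ fun i =>
    if s i = a then b i * (#{j | s j = a ∧ b i ≤ b j} : ℕ) else 0]
  refine Finset.sup_congr rfl fun i _ => ?_
  simp only [Function.comp_apply]
  rw [card_filter_comp_perm σ fun j => s j = a ∧ b (σ i) ≤ b j]

theorem samplePrice_comp_perm (σ : Equiv.Perm (Fin n)) (b : Fin n → ℝ≥0) (s : Fin n → Fin m)
    (i : Fin n) : samplePrice (b ∘ σ) (s ∘ σ) i = samplePrice b s (σ i) := by
  classical
  have ht : ∀ a, target (b ∘ σ) (s ∘ σ) a = target b s a := fun a =>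
    Finset.sup_congr rfl fun a _ => fixedRev_comp_perm σ b s a
  have hs : share (b ∘ σ) (s ∘ σ) i = share b s (σ i) := by
    unfold share
    congr 1
    ext k
    rw [ht, ← card_filter_comp_perm σ fun j =>
      j ≠ σ i ∧ s j = s (σ i) ∧ target b s (s (σ i)) / k ≤ b j]
    simp
  rw [samplePrice, samplePrice, ht, hs, Function.comp_apply]

/-- The expected payments of the random sampling auction do not depend on the names of the
bidders. -/
theorem sum_samplePay_comp_perm (σ : Equiv.Perm (Fin n)) (b : Fin n → ℝ≥0) (i : Fin n) :
    ∑ s : Fin n → Fin m, samplePay (b ∘ σ) s i = ∑ s : Fin n → Fin m, samplePay b s (σ i) := by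
  rw [← Equiv.sum_comp (Equiv.arrowCongr σ.symm (Equiv.refl (Fin m)))]
  refine Finset.sum_congr rfl fun s _ => ?_
  have : (Equiv.arrowCongr σ.symm (Equiv.refl (Fin m))) s = s ∘ σ := by
    ext; simp [Equiv.arrowCongr]
  rw [this, samplePay, samplePrice_comp_perm, samplePay, Function.comp_apply]

open Classical in
theorem share_spec (b : Fin n → ℝ≥0) (s : Fin n → Fin m) (i : Fin n) :
    share b s i ≤ #{j | j ≠ i ∧ s j = s i ∧ samplePrice b s i ≤ b j} + 1 :=
  Nat.findGreatest_spec (P := fun k => k ≤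
    #{j | j ≠ i ∧ s j = s i ∧ target b s (s i) / k ≤ b j} + 1) (m := 0) (Nat.zero_le n)
    (Nat.zero_le _)

open Classical in
theorem le_share {b : Fin n → ℝ≥0} {s : Fin n → Fin m} {i : Fin n} {k : ℕ}
    (h : k ≤ #{j | j ≠ i ∧ s j = s i ∧ target b s (s i) / k ≤ b j} + 1) : k ≤ share b s i := by
  -- The search bound `n` never binds, since there are only `n - 1` other bidders.
  refine Nat.le_findGreatest (h.trans ?_) h
  have : #{j | j ≠ i ∧ s j = s i ∧ target b s (s i) / k ≤ b j} ≤ #(univ.erase i) :=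
    Finset.card_le_card fun j hj => by simp_all
  have h2 : #(univ.erase i) + 1 = n := by
    rw [Finset.card_erase_add_one (mem_univ i), Finset.card_univ, Fintype.card_fin]
  omega

theorem share_pos (b : Fin n → ℝ≥0) (s : Fin n → Fin m) (i : Fin n) : 1 ≤ share b s i :=
  le_share (by omega)

open Classical in
theorem card_accepting {b : Fin n → ℝ≥0} {s : Fin n → Fin m} {i : Fin n} {p : ℝ≥0}
    (h : p ≤ b i) :
    #{j | s j = s i ∧ p ≤ b j} = #{j | j ≠ i ∧ s j = s i ∧ p ≤ b j} + 1 := by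
  rw [← Finset.card_insert_of_notMem (a := i) (s := {j | j ≠ i ∧ s j = s i ∧ p ≤ b j}) (by simp)]
  congr 1
  ext j
  by_cases hj : j = i <;> simp [hj, h]

theorem share_mul_samplePrice (b : Fin n → ℝ≥0) (s : Fin n → Fin m) (i : Fin n) :
    share b s i * samplePrice b s i = target b s (s i) := by
  have : (share b s i : ℝ≥0) ≠ 0 := by
    exact_mod_cast Nat.one_le_iff_ne_zero.1 (share_pos b s i)
  rw [samplePrice, mul_div_cancel₀ _ this]

/-- Two bidders of the same colour who can pay the price that one of them is offered are offered
the same price. -/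
theorem samplePrice_eq {b : Fin n → ℝ≥0} {s : Fin n → Fin m} {i j : Fin n} (hs : s j = s i)
    (hi : samplePrice b s i ≤ b i) (hj : samplePrice b s i ≤ b j) :
    samplePrice b s j = samplePrice b s i := by
  classical
  have h1 : share b s i ≤ share b s j := by
    refine le_share ?_
    have := share_spec b s i
    rw [← card_accepting hi, ← hs, card_accepting hj] at this
    rw [hs] at this ⊢
    exact this
  have h2 : samplePrice b s j ≤ samplePrice b s i := by
    rw [samplePrice, samplePrice, hs]
    have : (0 : ℝ≥0) < share b s i := by exact_mod_cast share_pos b s i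
    gcongr
  have h3 : share b s j ≤ share b s i := by
    refine le_share ?_
    have := share_spec b s j
    rw [← card_accepting (h2.trans hj), hs, card_accepting (h2.trans hi)] at this
    simpa only [samplePrice, hs] using this
  rw [samplePrice, samplePrice, hs, le_antisymm h1 h3]

theorem samplePay_eq {b : Fin n → ℝ≥0} {s : Fin n → Fin m} {i j : Fin n} (hs : s j = s i)
    (hi : samplePrice b s i ≤ b i) (hj : samplePrice b s i ≤ b j) :
    samplePay b s j = samplePrice b s i := by
  rw [samplePay, samplePrice_eq hs hi hj, postedPay_of_le hj]

/-- If one price sells to `N` bidders of colour `a` for a total of at least the target, then these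
`N` can share the target. A buyer among them has a share of at least `N`, at least as many bidders
as the share can pay the resulting price, and all of these are offered that same price. -/
theorem target_le_sum_samplePay {b : Fin n → ℝ≥0} {s : Fin n → Fin m} {a : Fin m}
    (h : target b s a ≤ fixedRev b s a) : target b s a ≤ ∑ i, samplePay b s i := by
  classical
  rcases eq_or_ne (target b s a) 0 with h0 | h0
  · rw [h0]; exact zero_le
  have hne : (univ : Finset (Fin n)).Nonempty := by
    by_contra hne
    rw [Finset.not_nonempty_iff_eq_empty] at hne
    apply h0
    simpa [fixedRev, hne] using h
  obtain ⟨i, -, hi⟩ := Finset.exists_mem_eq_sup univ hne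
    fun i => if s i = a then b i * (#{j | s j = a ∧ b i ≤ b j} : ℕ) else 0
  have hia : s i = a := by
    by_contra hia
    rw [if_neg hia] at hi
    exact h0 (le_antisymm (h.trans hi.le) zero_le)
  rw [if_pos hia] at hi
  subst hia
  set N := #{j | s j = s i ∧ b i ≤ b j} with hN
  have hNpos : 0 < N := Finset.card_pos.2 ⟨i, by simp⟩
  have hle : target b s (s i) / N ≤ b i :=
    div_le_of_le_mul₀ zero_le zero_le (h.trans hi.le)
  have hshare : N ≤ share b s i := by
    refine le_share ?_
    rw [← card_accepting hle]
    exact Finset.card_le_card fun j hj => by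
      simp only [Finset.mem_filter, mem_univ, true_and] at hj ⊢
      exact ⟨hj.1, hle.trans hj.2⟩
  have hprice : samplePrice b s i ≤ b i := by
    refine le_trans ?_ hle
    rw [samplePrice]
    have : (0 : ℝ≥0) < N := by exact_mod_cast hNpos
    gcongr
  calc target b s (s i) = share b s i * samplePrice b s i := (share_mul_samplePrice b s i).symm
    _ ≤ (#{j | s j = s i ∧ samplePrice b s i ≤ b j} : ℕ) * samplePrice b s i := by
        gcongr
        rw [card_accepting hprice]
        exact share_spec b s i
    _ = ∑ j ∈ {j | s j = s i ∧ samplePrice b s i ≤ b j}, samplePay b s j := by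
        rw [← nsmul_eq_mul, ← Finset.sum_const]
        refine Finset.sum_congr rfl fun j hj => ?_
        simp only [Finset.mem_filter, mem_univ, true_and] at hj
        rw [samplePay_eq hj.1 hprice hj.2]
    _ ≤ _ := Finset.sum_le_sum_of_subset (Finset.subset_univ _)

theorem colorCount_mul_le_fixedRev {b : Fin n → ℝ≥0} {c : ℝ≥0} {S : Finset (Fin n)}
    (hS : ∀ i ∈ S, c ≤ b i) (s : Fin n → Fin m) (a : Fin m) :
    colorCount S s a * c ≤ fixedRev b s a := by
  classical
  rcases Finset.eq_empty_or_nonempty ({i ∈ S | s i = a} : Finset (Fin n)) with h | h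
  · simp [colorCount, h]
  · obtain ⟨i, hi, hmin⟩ := Finset.exists_min_image _ b h
    have hi' := Finset.mem_filter.1 hi
    refine le_trans ?_ (Finset.le_sup (mem_univ i))
    rw [if_pos hi'.2, mul_comm]
    gcongr
    · exact hS i hi'.1
    · refine Finset.card_le_card fun j hj => ?_
      simpa using ⟨(Finset.mem_filter.1 hj).2, hmin j hj⟩

/-- The revenue is at least the second largest revenue of a part. -/
theorem sum_samplePay_ge [NeZero m] {b : Fin n → ℝ≥0} {c : ℝ≥0} {S : Finset (Fin n)}
    (hS : ∀ i ∈ S, c ≤ b i) {G : (Fin m → ℕ) → ℕ}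
    (hG : ∀ N a, G N ≤ (univ.erase a).sup N) (s : Fin n → Fin m) :
    G (colorCount S s) * c ≤ ∑ i, samplePay b s i := by
  -- At a colour with the largest revenue the target is the second largest one, hence attainable.
  obtain ⟨a, -, ha⟩ := Finset.exists_max_image univ (fixedRev b s) ⟨0, mem_univ _⟩
  refine le_trans ?_ (target_le_sum_samplePay (a := a)
    (Finset.sup_le fun a' _ => ha a' (mem_univ _)))
  rcases Nat.eq_zero_or_pos (G (colorCount S s)) with h0 | h0
  · simp [h0]
  have hne : (univ.erase a).Nonempty := by
    by_contra hne
    have := hG (colorCount S s) a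
    rw [Finset.not_nonempty_iff_eq_empty.1 hne, Finset.sup_empty] at this
    exact h0.ne' (Nat.le_zero.1 this)
  obtain ⟨a', ha', heq⟩ := Finset.exists_mem_eq_sup _ hne (colorCount S s)
  have h1 := hG (colorCount S s) a
  rw [heq] at h1
  calc (G (colorCount S s) : ℝ≥0) * c ≤ colorCount S s a' * c := by gcongr
    _ ≤ fixedRev b s a' := colorCount_mul_le_fixedRev hS s a'
    _ ≤ _ := Finset.le_sup ha'

theorem le_fixedRev (b : Fin n → ℝ≥0) (s : Fin n → Fin m) (i : Fin n) :
    b i ≤ fixedRev b s (s i) := by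
  have h := colorCount_mul_le_fixedRev (b := b) (c := b i) (S := {i}) (by simp) s (s i)
  simpa [colorCount, Finset.filter_singleton] using h

/-- A bidder who is not among the highest pays at most as much as all others together. -/
theorem samplePay_le_sum_erase {b : Fin n → ℝ≥0} {j k : Fin n} (h : b k < b j)
    (s : Fin n → Fin m) : samplePay b s k ≤ ∑ i ∈ univ.erase k, samplePay b s i := by
  classical
  rcases lt_or_ge (b k) (samplePrice b s k) with hk | hk
  · rw [samplePay, postedPay_of_lt hk]; exact zero_le
  have key : ∀ l, l ≠ k → s l = s k → samplePrice b s k ≤ b l →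
      samplePay b s k ≤ ∑ i ∈ univ.erase k, samplePay b s i := by
    intro l hl hs hle
    refine le_trans ?_ (Finset.single_le_sum (fun _ _ => zero_le)
      (Finset.mem_erase.2 ⟨hl, mem_univ l⟩))
    rw [samplePay_eq hs hk hle, samplePay_eq rfl hk hk]
  have hjk : j ≠ k := by rintro rfl; exact lt_irrefl _ h
  by_cases hs : s j = s k
  · exact key j hjk hs (hk.trans h.le)
  -- If `j` has another colour, the target is at least `b j > b k`. So `k` cannot carry it alone,
  -- and some bidder of its colour pays the same price.
  · have h1 : b j ≤ target b s (s k) :=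
      (le_fixedRev b s j).trans (Finset.le_sup (Finset.mem_erase.2 ⟨hs, mem_univ _⟩))
    have h2 : 2 ≤ share b s k := by
      by_contra h2
      have h3 : share b s k = 1 := by have := share_pos b s k; omega
      have h4 := share_mul_samplePrice b s k
      rw [h3, Nat.cast_one, one_mul] at h4
      exact absurd (h1.trans (h4.symm.le.trans hk)) h.not_ge
    have h3 := share_spec b s k
    obtain ⟨l, hl⟩ := Finset.card_pos.1 (show 0 < #{j | j ≠ k ∧ s j = s k ∧
      samplePrice b s k ≤ b j} by omega)
    simp only [Finset.mem_filter, mem_univ, true_and] at hl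
    exact key l hl.1 hl.2.1 hl.2.2

theorem medThree_le_sup_erase (N : Fin 3 → ℕ) (a : Fin 3) :
    medThree N ≤ (univ.erase a).sup N := by
  have h : ∀ b, b ≠ a → N b ≤ (univ.erase a).sup N := fun b hb =>
    Finset.le_sup (Finset.mem_erase.2 ⟨hb, mem_univ b⟩)
  unfold medThree med
  fin_cases a
  · have := h 1 (by decide); have := h 2 (by decide); omega
  · have := h 0 (by decide); have := h 2 (by decide); omega
  · have := h 0 (by decide); have := h 1 (by decide); omega

theorem minTwo_le_sup_erase (N : Fin 2 → ℕ) (a : Fin 2) :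
    minTwo N ≤ (univ.erase a).sup N := by
  have h : ∀ b, b ≠ a → N b ≤ (univ.erase a).sup N := fun b hb =>
    Finset.le_sup (Finset.mem_erase.2 ⟨hb, mem_univ b⟩)
  unfold minTwo
  fin_cases a
  · have := h 1 (by decide); omega
  · have := h 0 (by decide); omega

theorem sum_sum_samplePay_ge [NeZero m] {b : Fin n → ℝ≥0} {c : ℝ≥0} {S : Finset (Fin n)}
    (hS : ∀ i ∈ S, c ≤ b i) {G : (Fin m → ℕ) → ℕ}
    (hG : ∀ N a, G N ≤ (univ.erase a).sup N) :
    (m : ℝ≥0) ^ n * (throwSum #S G 0 * c) ≤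
      m ^ #S * ∑ s : Fin n → Fin m, ∑ i, samplePay b s i := by
  have h := sum_colorCount G S 0
  simp only [zero_add] at h
  have h' : (m : ℝ≥0) ^ n * throwSum #S G 0 =
      m ^ #S * ∑ s : Fin n → Fin m, (G (colorCount S s) : ℝ≥0) := by exact_mod_cast h.symm
  rw [← mul_assoc, h', mul_assoc, Finset.sum_mul]
  gcongr with s
  exact sum_samplePay_ge hS hG s

/-- The expected revenue of the sampling auction with three colours. -/
theorem sum_samplePay_three_ge {b : Fin n → ℝ≥0} {c : ℝ≥0} {S : Finset (Fin n)}
    (hS : ∀ i ∈ S, c ≤ b i) (hcard : 2 ≤ #S) :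
    50 * #S * c * 3 ^ n ≤ 171 * ∑ i, ∑ s : Fin n → Fin 3, samplePay b s i := by
  have h1 := sum_sum_samplePay_ge hS medThree_le_sup_erase
  have h2 : (50 * #S * 3 ^ #S : ℝ≥0) ≤ 171 * throwSum #S medThree 0 := by
    exact_mod_cast throwSum_medThree_ge hcard
  rw [Finset.sum_comm]
  rw [← mul_le_mul_iff_right₀ (show (0 : ℝ≥0) < 3 ^ #S by positivity)]
  push_cast at h1
  calc (3 : ℝ≥0) ^ #S * (50 * #S * c * 3 ^ n) = (50 * #S * 3 ^ #S) * (3 ^ n * c) := by ring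
    _ ≤ (171 * throwSum #S medThree 0) * (3 ^ n * c) := by gcongr
    _ = 171 * (3 ^ n * (throwSum #S medThree 0 * c)) := by ring
    _ ≤ 171 * (3 ^ #S * ∑ s : Fin n → Fin 3, ∑ i, samplePay b s i) := by gcongr
    _ = _ := by ring

/-- The expected revenue of the sampling auction with two colours. -/
theorem sum_samplePay_two_ge {b : Fin n → ℝ≥0} {c : ℝ≥0} {S : Finset (Fin n)}
    (hS : ∀ i ∈ S, c ≤ b i) (hcard : 2 ≤ #S) :
    3 * (#S - 1 : ℕ) * c * 2 ^ n ≤ 8 * ∑ i, ∑ s : Fin n → Fin 2, samplePay b s i := by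
  have h1 := sum_sum_samplePay_ge hS minTwo_le_sup_erase
  have h2 : (3 * (#S - 1 : ℕ) * 2 ^ #S : ℝ≥0) ≤ 8 * throwSum #S minTwo 0 := by
    exact_mod_cast throwSum_minTwo_ge hcard
  rw [Finset.sum_comm]
  rw [← mul_le_mul_iff_right₀ (show (0 : ℝ≥0) < 2 ^ #S by positivity)]
  push_cast at h1
  calc (2 : ℝ≥0) ^ #S * (3 * (#S - 1 : ℕ) * c * 2 ^ n)
      = (3 * (#S - 1 : ℕ) * 2 ^ #S) * (2 ^ n * c) := by ring
    _ ≤ (8 * throwSum #S minTwo 0) * (2 ^ n * c) := by gcongr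
    _ = 8 * (2 ^ n * (throwSum #S minTwo 0 * c)) := by ring
    _ ≤ 8 * (2 ^ #S * ∑ s : Fin n → Fin 2, ∑ i, samplePay b s i) := by gcongr
    _ = _ := by ring

end

/-! ### Posted price auctions -/

/-- The auction that offers to each bidder a price. -/
def postedAuction {n : ℕ} (price : (Fin n → ℝ≥0) → Fin n → ℝ≥0) : DetAuction n where
  Serves b i := price b i ≤ b i
  pay b i := postedPay (price b i) (b i)
  pay_le b i h := by rw [postedPay_of_le h]; exact h
  pay_eq_zero b i h := if_neg h

theorem postedAuction_truthful {n : ℕ} {price : (Fin n → ℝ≥0) → Fin n → ℝ≥0}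
    (h : ∀ b i z, price (Function.update b i z) i = price b i) :
    (postedAuction price).Truthful := by
  intro b i z
  have hpos : ∀ c y, price c i ≤ c i → (postedAuction price).utility c i y = y - price c i := by
    intro c y hc
    rw [DetAuction.utility, if_pos (show (postedAuction price).Serves c i from hc)]
    exact congrArg (fun p : ℝ≥0 => (y : ℝ) - p) (postedPay_of_le hc)
  have hneg : ∀ c y, ¬ price c i ≤ c i → (postedAuction price).utility c i y = 0 := by
    intro c y hc
    rw [DetAuction.utility, if_neg (show ¬ (postedAuction price).Serves c i from hc)]
  by_cases h1 : price b i ≤ z <;> by_cases h2 : price b i ≤ b i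
  · rw [hpos _ _ (by simpa [h] using h1), hpos _ _ h2, h]
  · rw [hpos _ _ (by simpa [h] using h1), hneg _ _ h2, h, sub_nonpos]
    exact_mod_cast (not_le.1 h2).le
  · rw [hneg _ _ (by simpa [h] using h1), hpos _ _ h2, sub_nonneg]
    exact_mod_cast h2
  · rw [hneg _ _ (by simpa [h] using h1), hneg _ _ h2]

theorem postedAuction_price {n : ℕ} {price : (Fin n → ℝ≥0) → Fin n → ℝ≥0}
    (h : ∀ b i z, price (Function.update b i z) i = price b i) (b : Fin n → ℝ≥0) (i : Fin n) :
    (postedAuction price).price b i = price b i := by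
  simp only [DetAuction.price, postedAuction, h, Function.update_self]
  refine le_antisymm (iInf₂_le (price b i) le_rfl) (le_iInf₂ fun z hz => ?_)
  exact_mod_cast hz

/-- In an online mechanism with posted prices every bidder reports its true value. -/
theorem OnlineMechanism.truthful (A : OnlineMechanism) : A.Truthful := by
  intro n vhat b π ω t z
  have h : A.offer vhat (Function.update b (π t) z) π ω t = A.offer vhat b π ω t := by
    rw [OnlineMechanism.offer, OnlineMechanism.offer]
    congr 1
    ext s
    rw [Function.update_of_ne]
    intro hs
    have := congrArg Fin.val (π.injective hs)
    simp only [Fin.val_castLE] at this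
    exact (s.isLt.ne this)
  simp only [OnlineMechanism.utility, h, Function.update_self]
  split_ifs with h1 h2 h2
  · exact le_rfl
  · rw [sub_nonpos]
    have := ENNReal.toReal_mono (ne_top_of_le_ne_top ENNReal.coe_ne_top h1) (not_le.1 h2).le
    simpa using this
  · rw [sub_nonneg]
    have := ENNReal.toReal_mono ENNReal.coe_ne_top h2
    simpa using this
  · exact le_rfl

theorem OnlineMechanism.pay_of_offer (A : OnlineMechanism) {n : ℕ} {vhat b : Fin n → ℝ≥0}
    {π : Equiv.Perm (Fin n)} {ω : A.Ω} {t : Fin n} {p : ℝ≥0}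
    (h : A.offer vhat b π ω t = p) : A.pay vhat b π ω t = postedPay p (b (π t)) := by
  rw [OnlineMechanism.pay, h]
  by_cases hp : p ≤ b (π t)
  · rw [if_pos (by exact_mod_cast hp), postedPay_of_le hp]; rfl
  · rw [if_neg (by exact_mod_cast hp), postedPay_of_lt (not_le.1 hp)]; rfl

/-! ### Mixtures of predictions, second prices and random sampling -/

/-- The highest bid of the other bidders. -/
def vickPrice {n : ℕ} (b : Fin n → ℝ≥0) (i : Fin n) : ℝ≥0 := (univ.erase i).sup b

theorem vickPrice_update {n : ℕ} (b : Fin n → ℝ≥0) (i : Fin n) (z : ℝ≥0) :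
    vickPrice (Function.update b i z) i = vickPrice b i :=
  Finset.sup_congr rfl fun _ hj => Function.update_of_ne (Finset.ne_of_mem_erase hj) _ _

theorem vickPrice_comp_perm {n : ℕ} (σ : Equiv.Perm (Fin n)) (b : Fin n → ℝ≥0) (i : Fin n) :
    vickPrice (b ∘ σ) i = vickPrice b (σ i) := by
  refine le_antisymm (Finset.sup_le fun j hj => ?_) (Finset.sup_le fun j hj => ?_)
  · exact Finset.le_sup (f := b) (Finset.mem_erase.2
      ⟨σ.injective.ne (Finset.ne_of_mem_erase hj), mem_univ _⟩)
  · have : σ.symm j ∈ univ.erase i := Finset.mem_erase.2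
      ⟨fun h => Finset.ne_of_mem_erase hj (by rw [← h]; simp), mem_univ _⟩
    simpa [vickPrice] using Finset.le_sup (f := b ∘ σ) this

/-- A rule that tells, out of `D` equally likely cases, in how many ones a bidder is offered its
prediction (`pred`) and in how many ones the highest other bid (`vick`); in the remaining cases it
is offered the price of the random sampling auction. -/
structure MixRule (D : ℕ) where
  pred : (n : ℕ) → (Fin n → ℝ≥0) → (Fin n → ℝ≥0) → Fin n → ℕ
  vick : (n : ℕ) → (Fin n → ℝ≥0) → (Fin n → ℝ≥0) → Fin n → ℕ
  add_le : ∀ n vhat b i, pred n vhat b i + vick n vhat b i ≤ D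
  pred_update : ∀ n vhat b i z, pred n vhat (Function.update b i z) i = pred n vhat b i
  vick_update : ∀ n vhat b i z, vick n vhat (Function.update b i z) i = vick n vhat b i
  pred_comp_perm : ∀ n (σ : Equiv.Perm (Fin n)) vhat b i,
    pred n (vhat ∘ σ) (b ∘ σ) i = pred n vhat b (σ i)
  vick_comp_perm : ∀ n (σ : Equiv.Perm (Fin n)) vhat b i,
    vick n (vhat ∘ σ) (b ∘ σ) i = vick n vhat b (σ i)

/-- The random seed for `n` bidders: a colouring and one of `D` cases. -/
abbrev Seed (m D n : ℕ) : Type := (Fin n → Fin m) × Fin D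

namespace MixRule

variable {D m : ℕ} (R : MixRule D) {n : ℕ}

def price (vhat b : Fin n → ℝ≥0) (x : Seed m D n) (i : Fin n) : ℝ≥0 :=
  if (x.2 : ℕ) < R.pred n vhat b i then vhat i
  else if (x.2 : ℕ) < R.pred n vhat b i + R.vick n vhat b i then vickPrice b i
  else samplePrice b x.1 i

theorem price_update (vhat : Fin n → ℝ≥0) (x : Seed m D n) (b : Fin n → ℝ≥0) (i : Fin n)
    (z : ℝ≥0) : R.price vhat (Function.update b i z) x i = R.price vhat b x i := by
  simp only [price, R.pred_update, R.vick_update, vickPrice_update, samplePrice_update]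

theorem price_of_pred_eq {R : MixRule D} (h : ∀ n v i, R.pred n v v i = D) (v : Fin n → ℝ≥0)
    (x : Seed m D n) (i : Fin n) : R.price v v x i = v i := by
  rw [price, h, if_pos x.2.isLt]

/-- The payments of bidder `i`, summed over all seeds. -/
def totalPay (m : ℕ) (vhat b : Fin n → ℝ≥0) (i : Fin n) : ℝ≥0 :=
  ∑ x : Seed m D n, postedPay (R.price vhat b x i) (b i)

theorem totalPay_eq (vhat b : Fin n → ℝ≥0) (i : Fin n) :
    R.totalPay m vhat b i =
      m ^ n * (R.pred n vhat b i * postedPay (vhat i) (b i)) +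
      m ^ n * (R.vick n vhat b i * postedPay (vickPrice b i) (b i)) +
      (D - R.pred n vhat b i - R.vick n vhat b i : ℕ) *
        ∑ s : Fin n → Fin m, samplePay b s i := by
  have hcase : ∀ s : Fin n → Fin m,
      ∑ d : Fin D, postedPay (R.price vhat b (s, d) i) (b i) =
        R.pred n vhat b i * postedPay (vhat i) (b i) +
        R.vick n vhat b i * postedPay (vickPrice b i) (b i) +
        (D - R.pred n vhat b i - R.vick n vhat b i : ℕ) * samplePay b s i := by
    intro s
    simp only [price]
    rw [Fin.sum_univ_eq_sum_range (fun d => postedPay (if d < R.pred n vhat b i then vhat i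
      else if d < R.pred n vhat b i + R.vick n vhat b i then vickPrice b i
      else samplePrice b s i) (b i)) D]
    have hD : D = R.pred n vhat b i + R.vick n vhat b i +
        (D - R.pred n vhat b i - R.vick n vhat b i) := by
      have := R.add_le n vhat b i
      omega
    generalize R.pred n vhat b i = p at hD ⊢
    generalize R.vick n vhat b i = q at hD ⊢
    generalize D - p - q = r at hD ⊢
    rw [hD, Finset.sum_range_add, Finset.sum_range_add]
    refine congrArg₂ _ (congrArg₂ _ ?_ ?_) ?_
    · rw [Finset.sum_congr rfl fun d hd => by rw [if_pos (Finset.mem_range.1 hd)]]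
      simp
    · rw [Finset.sum_congr rfl fun d hd => by
        rw [if_neg (by omega), if_pos (by have := Finset.mem_range.1 hd; omega)]]
      simp
    · rw [Finset.sum_congr rfl fun d _ => by
        rw [if_neg (by omega : ¬ p + q + d < p), if_neg (by omega)]]
      simp [samplePay]
  rw [totalPay, Fintype.sum_prod_type, Finset.sum_congr rfl fun s _ => hcase s]
  simp only [Finset.sum_add_distrib, Finset.sum_const, Finset.card_univ, Fintype.card_fun,
    Fintype.card_fin, nsmul_eq_mul, Nat.cast_pow, Finset.mul_sum]

theorem totalPay_comp_perm (σ : Equiv.Perm (Fin n)) (vhat b : Fin n → ℝ≥0) (i : Fin n) :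
    R.totalPay m (vhat ∘ σ) (b ∘ σ) i = R.totalPay m vhat b (σ i) := by
  rw [totalPay_eq, totalPay_eq, R.pred_comp_perm, R.vick_comp_perm, vickPrice_comp_perm,
    sum_samplePay_comp_perm]
  rfl

/-- The payment of the bidder who arrives at time `t`, as a function of the seed. -/
def seedPay (vhat v : Fin n → ℝ≥0) (π : Equiv.Perm (Fin n)) (t : Fin n)
    (x : Seed m D (t + 1)) : ℝ≥0 :=
  postedPay (if (t : ℕ) = 0 then vhat (π t)
    else R.price (fun s => vhat (π (Fin.castLE t.isLt s)))
      (fun s => v (π (Fin.castLE t.isLt s))) x (Fin.last t)) (v (π t))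

/-- The expected payment of the bidder who arrives at time `t`. -/
def stepPay (m : ℕ) (vhat v : Fin n → ℝ≥0) (π : Equiv.Perm (Fin n)) (t : Fin n) : ℝ :=
  (∑ x : Seed m D (t + 1), (R.seedPay vhat v π t x : ℝ)) / (m ^ ((t : ℕ) + 1) * D)

theorem stepPay_nonneg (m : ℕ) (vhat v : Fin n → ℝ≥0) (π : Equiv.Perm (Fin n)) (t : Fin n) :
    0 ≤ R.stepPay m vhat v π t := by
  unfold stepPay; positivity

theorem stepPay_of_ne_zero (vhat v : Fin n → ℝ≥0) (π : Equiv.Perm (Fin n)) {t : Fin n}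
    (ht : (t : ℕ) ≠ 0) : R.stepPay m vhat v π t =
      R.totalPay m (fun s => vhat (π (Fin.castLE t.isLt s)))
        (fun s => v (π (Fin.castLE t.isLt s))) (Fin.last t) / (m ^ ((t : ℕ) + 1) * D) := by
  have hlast : Fin.castLE t.isLt (Fin.last (t : ℕ)) = t := by ext; simp
  simp [stepPay, seedPay, totalPay, ht, hlast]

variable [NeZero m] [NeZero D]

/-- The uniform distribution of the seeds for all numbers of bidders. -/
def seedMeasure (m D : ℕ) [NeZero m] [NeZero D] : Measure (∀ n, Seed m D n) :=
  Measure.infinitePi fun n => (PMF.uniformOfFintype (Seed m D n)).toMeasure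

instance : IsProbabilityMeasure (seedMeasure m D) := by
  unfold seedMeasure; infer_instance

theorem integrable_seed (k : ℕ) (f : Seed m D k → ℝ) :
    Integrable (fun ω => f (ω k)) (seedMeasure m D) :=
  (measurePreserving_eval_infinitePi
    (fun n => (PMF.uniformOfFintype (Seed m D n)).toMeasure) k).integrable_comp_of_integrable
    (g := f) (Integrable.of_finite)

theorem integral_seed (k : ℕ) (f : Seed m D k → ℝ) :
    ∫ ω, f (ω k) ∂(seedMeasure m D) = (∑ x, f x) / (m ^ k * D) := by
  have h := (measurePreserving_eval_infinitePi
    (fun n => (PMF.uniformOfFintype (Seed m D n)).toMeasure) k)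
  have h2 : ∫ ω, f (ω k) ∂(seedMeasure m D) =
      ∫ x, f x ∂(PMF.uniformOfFintype (Seed m D k)).toMeasure := by
    rw [← h.map_eq, integral_map h.measurable.aemeasurable
      (Measurable.of_discrete.aestronglyMeasurable)]
    rfl
  rw [h2, PMF.integral_eq_sum, Finset.sum_div]
  refine Finset.sum_congr rfl fun x _ => ?_
  simp [div_eq_inv_mul]

/-- The offline mechanism that follows the rule. -/
def mechanism (m : ℕ) [NeZero m] : Mechanism where
  Ω := ∀ n, Seed m D n
  μ := seedMeasure m D
  auction n vhat ω := postedAuction fun b => R.price vhat b (ω n)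
  measurableSet_serves n vhat b i :=
    (MeasurableSet.of_discrete (s := {x : Seed m D n | R.price vhat b x i ≤ b i})).preimage
      (measurable_pi_apply n)
  measurable_pay n vhat b i :=
    (Measurable.of_discrete (f := fun x : Seed m D n =>
      postedPay (R.price vhat b x i) (b i))).comp (measurable_pi_apply n)

theorem mechanism_truthful : (R.mechanism m).Truthful := fun _ vhat ω =>
  postedAuction_truthful fun b i z => R.price_update vhat (ω _) b i z

theorem mechanism_revenue (vhat v : Fin n → ℝ≥0) :
    (R.mechanism m).revenue n vhat v = (∑ i, (R.totalPay m vhat v i : ℝ)) / (m ^ n * D) := by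
  have h := integral_seed (m := m) (D := D) n
    fun x => ∑ i, (postedPay (R.price vhat v x i) (v i) : ℝ)
  refine h.trans ?_
  rw [Finset.sum_comm]
  simp [totalPay]

/-- The online mechanism that is obtained from the rule. -/
def online (m : ℕ) [NeZero m] : OnlineMechanism := OSAP (R.mechanism m) R.mechanism_truthful

theorem online_offer (vhat v : Fin n → ℝ≥0) (π : Equiv.Perm (Fin n)) (ω : ∀ n, Seed m D n)
    (t : Fin n) :
    (R.online m).offer vhat v π ω t = if (t : ℕ) = 0 then (vhat (π t) : ℝ≥0∞) else
      (R.price (fun s => vhat (π (Fin.castLE t.isLt s))) (fun s => v (π (Fin.castLE t.isLt s)))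
        (ω (t + 1)) (Fin.last t) : ℝ≥0) := by
  have hlast : Fin.castLE t.isLt (Fin.last (t : ℕ)) = t := by ext; simp
  simp only [OnlineMechanism.offer, online, OSAP]
  split_ifs with h
  · rw [hlast]
  · have hprice := postedAuction_price (price := fun b =>
      R.price (fun s => vhat (π (Fin.castLE t.isLt s))) b (ω (t + 1)))
      (fun b i z => R.price_update _ _ b i z)
    -- `OSAP` runs the auction with a dummy bid 0 of the newcomer, which its own price ignores.
    have hsnoc : (Fin.snoc (α := fun _ => ℝ≥0)
        (fun s : Fin (t : ℕ) => v (π (Fin.castLE t.isLt.le s))) 0) =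
        Function.update (fun s => v (π (Fin.castLE t.isLt s))) (Fin.last (t : ℕ)) 0 := by
      ext s
      refine Fin.lastCases ?_ (fun s => ?_) s
      · simp
      · rw [Fin.snoc_castSucc, Function.update_of_ne (Fin.castSucc_lt_last s).ne]
        rfl
    change (postedAuction _).price _ _ = _
    rw [hprice, hsnoc, R.price_update]

theorem online_pay (vhat v : Fin n → ℝ≥0) (π : Equiv.Perm (Fin n)) (ω : ∀ n, Seed m D n)
    (t : Fin n) : (R.online m).pay vhat v π ω t = R.seedPay vhat v π t (ω (t + 1)) := by
  refine OnlineMechanism.pay_of_offer _ ((R.online_offer vhat v π ω t).trans ?_)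
  split_ifs <;> rfl

/-- The bidder at time `t` uses only the coordinate `t + 1` of the seed. Linearity of the integral
suffices; independence of the coordinates plays no role. -/
theorem online_revenue (vhat v : Fin n → ℝ≥0) :
    (R.online m).revenue n vhat v =
      (∑ π : Equiv.Perm (Fin n), ∑ t, R.stepPay m vhat v π t) / n.factorial := by
  rw [OnlineMechanism.revenue]
  congr 1
  refine Finset.sum_congr rfl fun π _ => ?_
  refine (integral_congr_ae (Filter.Eventually.of_forall fun ω =>
    Finset.sum_congr rfl fun t _ => R.online_pay vhat v π ω t)).trans ?_
  refine (integral_finsetSum _ fun (t : Fin n) _ => integrable_seed (m := m) (D := D) (t + 1)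
    fun x => (R.seedPay vhat v π t x : ℝ)).trans ?_
  exact Finset.sum_congr rfl fun t _ => integral_seed (m := m) (D := D) (t + 1)
    fun x => (R.seedPay vhat v π t x : ℝ)

end MixRule

/-! ### Random orders of arrival -/

/-- The bidders who have arrived up to time `t`. -/
def arrived {n : ℕ} (π : Equiv.Perm (Fin n)) (t : Fin n) (s : Fin ((t : ℕ) + 1)) : Fin n :=
  π (Fin.castLE t.isLt s)

theorem arrived_last {n : ℕ} (π : Equiv.Perm (Fin n)) (t : Fin n) :
    arrived π t (Fin.last t) = π t := by
  refine congrArg π ?_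
  ext; simp

/-- In a random order, the last of the arrived bidders is a uniformly random one of them. -/
theorem sum_perm_last {n : ℕ} (t : Fin n)
    (φ : (Fin ((t : ℕ) + 1) → Fin n) → Fin ((t : ℕ) + 1) → ℝ)
    (hφ : ∀ ι (σ : Equiv.Perm (Fin ((t : ℕ) + 1))) i, φ (ι ∘ σ) i = φ ι (σ i)) :
    ((t : ℕ) + 1) * ∑ π : Equiv.Perm (Fin n), φ (arrived π t) (Fin.last t) =
      ∑ π : Equiv.Perm (Fin n), ∑ i, φ (arrived π t) i := by
  have key : ∀ i, ∑ π : Equiv.Perm (Fin n), φ (arrived π t) (Fin.last t) =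
      ∑ π : Equiv.Perm (Fin n), φ (arrived π t) i := by
    intro i
    -- Interchanging the arrival times `i` and `t` permutes the orders and leaves the set of arrived
    -- bidders unchanged.
    rw [← Equiv.sum_comp (Equiv.mulRight
      (Equiv.swap (Fin.castLE t.isLt i) (Fin.castLE t.isLt (Fin.last t))))]
    refine Finset.sum_congr rfl fun π _ => ?_
    have h : arrived (π * Equiv.swap (Fin.castLE t.isLt i) (Fin.castLE t.isLt (Fin.last t))) t =
        arrived π t ∘ Equiv.swap i (Fin.last t) := by
      funext s
      simp only [arrived, Equiv.Perm.mul_apply, Function.comp_apply]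
      rw [(Fin.castLE_injective t.isLt).swap_apply]
    rw [Equiv.coe_mulRight, h, hφ, Equiv.swap_apply_right]
  rw [Finset.sum_comm, ← Finset.sum_congr rfl fun i _ => key i]
  simp

/-- All but one of the bidders in `S` arrive after another one. -/
theorem card_sub_one_le_card_arrivals {n : ℕ} (S : Finset (Fin n)) (π : Equiv.Perm (Fin n)) :
    #S - 1 ≤ #{t | arrived π t (Fin.last t) ∈ S ∧ 2 ≤ #{s | arrived π t s ∈ S}} := by
  rcases S.eq_empty_or_nonempty with rfl | hS
  · simp
  set T : Finset (Fin n) := {t | π t ∈ S} with hT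
  have hcard : #T = #S := by
    have : T = S.map π.symm.toEmbedding := by
      ext t; simp [hT, Finset.mem_map_equiv]
    rw [this, Finset.card_map]
  have hTne : T.Nonempty := Finset.card_pos.1 (hcard ▸ hS.card_pos)
  -- `T` consists of the arrival times of `S`; only its earliest one lacks a predecessor in `S`.
  rw [← hcard, ← Finset.card_erase_of_mem (T.min'_mem hTne)]
  refine Finset.card_le_card fun t ht => ?_
  obtain ⟨hne, htT⟩ := Finset.mem_erase.1 ht
  have hlt : T.min' hTne < t := lt_of_le_of_ne (T.min'_le t htT) hne.symm
  have hmin := T.min'_mem hTne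
  generalize T.min' hTne = u at hlt hmin
  simp only [hT, Finset.mem_filter, mem_univ, true_and] at htT hmin ⊢
  rw [arrived_last]
  refine ⟨htT, ?_⟩
  have hu : arrived π t ⟨u, by have := Fin.lt_def.1 hlt; omega⟩ = π u := rfl
  refine Finset.one_lt_card.2 ⟨⟨u, by have := Fin.lt_def.1 hlt; omega⟩, ?_, Fin.last t, ?_, ?_⟩
  · simp [hu, hmin]
  · simp [arrived_last, htT]
  · intro h
    have := congrArg Fin.val h
    simp only [Fin.val_last] at this
    have := Fin.lt_def.1 hlt
    omega

namespace MixRule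

variable {D m : ℕ} (R : MixRule D) [NeZero m] [NeZero D]

/-- If `r ≥ 2` of the `t + 1` arrived bidders are in `S`, the offline revenue on them is at least `β
r c / α`, and the newcomer pays a fraction `1 / (t + 1)` of it on average. It lies in `S` with
probability `r / (t + 1)`, so this amounts to a charge `β c / α` whenever a bidder of `S` arrives
who is not the first one of `S`. -/
theorem online_revenue_ge {f : Benchmark} {α β : ℝ} (hα : 0 < α) (hβ : 0 ≤ β)
    (hrob : IsRobust (R.mechanism m).revenue α f)
    (hlow : ∀ (n : ℕ) (v : Fin n → ℝ≥0) (S : Finset (Fin n)) (c : ℝ≥0), (∀ i ∈ S, c ≤ v i) →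
      2 ≤ #S → β * #S * c ≤ f n v)
    {n : ℕ} (vhat v : Fin n → ℝ≥0) {S : Finset (Fin n)} {c : ℝ≥0} (hS : ∀ i ∈ S, c ≤ v i) :
    (#S - 1 : ℕ) * (β * c / α) ≤ (R.online m).revenue n vhat v := by
  have hstep : ∀ t : Fin n, ∑ π : Equiv.Perm (Fin n),
      (if arrived π t (Fin.last t) ∈ S ∧ 2 ≤ #{s | arrived π t s ∈ S} then β * c / α else 0) ≤
      ∑ π : Equiv.Perm (Fin n), R.stepPay m vhat v π t := by
    intro t
    rcases eq_or_ne (t : ℕ) 0 with h0 | h0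
    · refine Finset.sum_le_sum fun π _ => ?_
      have hcard : #{s | arrived π t s ∈ S} ≤ 1 := by
        refine (Finset.card_le_univ _).trans ?_
        simp [h0]
      rw [if_neg (by omega)]
      exact R.stepPay_nonneg m vhat v π t
    · have h1 := sum_perm_last t
        (fun ι i => if ι i ∈ S ∧ 2 ≤ #{s | ι s ∈ S} then β * c / α else 0) (by
          intro ι σ i
          have := card_filter_comp_perm σ fun s => ι s ∈ S
          simp only [Function.comp_apply, this])
      have h2 := sum_perm_last t
        (fun ι i => (R.totalPay m (vhat ∘ ι) (v ∘ ι) i : ℝ) / (m ^ ((t : ℕ) + 1) * D)) (by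
          intro ι σ i
          have := R.totalPay_comp_perm (m := m) σ (vhat ∘ ι) (v ∘ ι) i
          simp only [← this, Function.comp_assoc])
      have h3 : ∑ π : Equiv.Perm (Fin n), R.stepPay m vhat v π t =
          ∑ π : Equiv.Perm (Fin n), (R.totalPay m (vhat ∘ arrived π t) (v ∘ arrived π t)
            (Fin.last t) : ℝ) / (m ^ ((t : ℕ) + 1) * D) :=
        Finset.sum_congr rfl fun π _ => R.stepPay_of_ne_zero vhat v π h0
      -- Multiplication by `t + 1` turns the payment of the last bidder into the whole revenue from
      -- the arrived ones, and likewise for the charges.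
      rw [h3, ← mul_le_mul_iff_right₀ (show (0 : ℝ) < (t : ℕ) + 1 by positivity)]
      refine h1.le.trans (le_trans ?_ h2.ge)
      refine Finset.sum_le_sum fun π _ => ?_
      rw [← Finset.sum_div]
      have h4 := hrob ((t : ℕ) + 1) (vhat ∘ arrived π t) (v ∘ arrived π t)
      rw [mechanism_revenue] at h4
      refine le_trans ?_ h4
      by_cases h5 : 2 ≤ #{s | arrived π t s ∈ S}
      · simp only [h5, and_true]
        rw [← Finset.sum_filter, Finset.sum_const, nsmul_eq_mul]
        have h6 := hlow _ (v ∘ arrived π t) ({s | arrived π t s ∈ S} : Finset _) c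
          (fun i hi => hS _ (Finset.mem_filter.1 hi).2) h5
        rw [mul_div_assoc', div_le_div_iff_of_pos_right hα]
        linarith
      · simp only [h5, and_false, if_false, Finset.sum_const_zero]
        positivity
  rw [online_revenue, le_div_iff₀ (by positivity), Finset.sum_comm]
  refine le_trans ?_ (Finset.sum_le_sum fun t _ => hstep t)
  rw [Finset.sum_comm]
  have hpath : ∀ π : Equiv.Perm (Fin n), (#S - 1 : ℕ) * (β * c / α) ≤
      ∑ t, (if arrived π t (Fin.last t) ∈ S ∧ 2 ≤ #{s | arrived π t s ∈ S}
        then β * c / α else 0) := by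
    intro π
    rw [← Finset.sum_filter, Finset.sum_const, nsmul_eq_mul]
    gcongr
    exact card_sub_one_le_card_arrivals S π
  refine le_trans (le_of_eq ?_) (Finset.sum_le_sum fun π _ => hpath π)
  rw [Finset.sum_const, Finset.card_univ, Fintype.card_perm, Fintype.card_fin, nsmul_eq_mul,
    mul_comm]

/-- The online mechanism loses at most a factor of two. -/
theorem online_isRobust {f : Benchmark} {α β : ℝ} (hα : 0 < α) (hβ : 0 ≤ β)
    (hrob : IsRobust (R.mechanism m).revenue α f)
    (hlow : ∀ (n : ℕ) (v : Fin n → ℝ≥0) (S : Finset (Fin n)) (c : ℝ≥0), (∀ i ∈ S, c ≤ v i) →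
      2 ≤ #S → β * #S * c ≤ f n v)
    (hup : ∀ (n : ℕ) (v : Fin n → ℝ≥0), ∃ (S : Finset (Fin n)) (c : ℝ≥0),
      (∀ i ∈ S, c ≤ v i) ∧ (f n v : ℝ) ≤ 2 * ((#S - 1 : ℕ) * (β * c))) :
    IsRobust (R.online m).revenue (2 * α) f := by
  intro n vhat v
  obtain ⟨S, c, hS, hf⟩ := hup n v
  refine le_trans ?_ (R.online_revenue_ge hα hβ hrob hlow vhat v hS)
  rw [div_le_iff₀ (by positivity)]
  refine hf.trans (le_of_eq ?_)
  field_simp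

variable {R}

theorem mechanism_isConsistent (h : ∀ n v i, R.pred n v v i = D) :
    IsConsistent (R.mechanism m).revenue 1 OPT := by
  intro n v
  have hm : (0 : ℝ) < m := Nat.cast_pos.2 (Nat.pos_of_neZero m)
  have hD : (0 : ℝ) < D := Nat.cast_pos.2 (Nat.pos_of_neZero D)
  rw [mechanism_revenue, div_one, le_div_iff₀ (by positivity)]
  simp only [totalPay, price_of_pred_eq h, postedPay_of_le le_rfl, Finset.sum_const,
    Finset.card_univ, Fintype.card_prod, Fintype.card_fun, Fintype.card_fin, OPT]
  push_cast
  rw [← Finset.smul_sum, nsmul_eq_mul]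
  push_cast
  linarith

theorem online_isConsistent (h : ∀ n v i, R.pred n v v i = D) :
    IsConsistent (R.online m).revenue 1 OPT := by
  intro n v
  have hm : (0 : ℝ) < m := Nat.cast_pos.2 (Nat.pos_of_neZero m)
  have hD : (0 : ℝ) < D := Nat.cast_pos.2 (Nat.pos_of_neZero D)
  have hseed : ∀ (π : Equiv.Perm (Fin n)) (t : Fin n) (x : Seed m D ((t : ℕ) + 1)),
      R.seedPay v v π t x = v (π t) := by
    intro π t x
    have hlast := congrArg v (arrived_last π t)
    rw [seedPay, price_of_pred_eq h]
    refine (congrArg (fun p => postedPay p (v (π t))) ?_).trans (postedPay_of_le le_rfl)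
    split_ifs
    · rfl
    · exact hlast
  have hstep : ∀ (π : Equiv.Perm (Fin n)) (t : Fin n), R.stepPay m v v π t = v (π t) := by
    intro π t
    rw [stepPay, div_eq_iff (by positivity)]
    simp only [hseed, Finset.sum_const, Finset.card_univ, Fintype.card_prod, Fintype.card_fun,
      Fintype.card_fin, nsmul_eq_mul]
    push_cast
    ring
  rw [online_revenue, div_one, le_div_iff₀ (by positivity)]
  simp only [hstep]
  rw [Finset.sum_congr rfl fun π _ => Equiv.sum_comp π fun i => (v i : ℝ), Finset.sum_const,
    Finset.card_univ, Fintype.card_perm, Fintype.card_fin, nsmul_eq_mul, mul_comm]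
  simp [OPT]

end MixRule

/-! ### Benchmarks -/

/-- The bidders in the order of non-increasing values. -/
def descOrder {n : ℕ} (v : Fin n → ℝ≥0) : Equiv.Perm (Fin n) := Fin.revPerm.trans (Tuple.sort v)

theorem sortedDesc_antitone {n : ℕ} (v : Fin n → ℝ≥0) : Antitone (sortedDesc v) := fun _ _ h =>
  Tuple.monotone_sort v (Fin.rev_le_rev.2 h)

/-- This replaces sorted values by a set `S` and a threshold `c`. The bound outside `S` later serves
to find the highest bidders inside `S`. -/
theorem exists_top_set {n : ℕ} (v : Fin n → ℝ≥0) (j : Fin n) :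
    ∃ S : Finset (Fin n), #S = (j : ℕ) + 1 ∧ (∀ i ∈ S, sortedDesc v j ≤ v i) ∧
      ∀ i ∉ S, v i ≤ sortedDesc v j := by
  refine ⟨(Iic j).map (descOrder v).toEmbedding, by simp, fun i hi => ?_, fun i hi => ?_⟩
  · obtain ⟨p, hp, rfl⟩ := Finset.mem_map.1 hi
    exact sortedDesc_antitone v (Finset.mem_Iic.1 hp)
  · obtain ⟨p, rfl⟩ := (descOrder v).surjective i
    refine sortedDesc_antitone v (not_le.1 fun hp => hi ?_).le
    exact Finset.mem_map.2 ⟨p, Finset.mem_Iic.2 hp, rfl⟩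

theorem le_sortedDesc {n : ℕ} {v : Fin n → ℝ≥0} {S : Finset (Fin n)} {c : ℝ≥0}
    (hS : ∀ i ∈ S, c ≤ v i) {j : Fin n} (hj : (j : ℕ) < #S) : c ≤ sortedDesc v j := by
  by_contra! hlt
  have hsub : S ⊆ (Iio j).map (descOrder v).toEmbedding := by
    intro i hi
    obtain ⟨p, rfl⟩ := (descOrder v).surjective i
    refine Finset.mem_map.2 ⟨p, Finset.mem_Iio.2 (not_le.1 fun hp => ?_), rfl⟩
    exact ((hS _ hi).trans (sortedDesc_antitone v hp)).not_gt hlt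
  have := Finset.card_le_card hsub
  simp at this
  omega

theorem exists_F2_eq {n : ℕ} (v : Fin n → ℝ≥0) (h : F2 n v ≠ 0) :
    ∃ (S : Finset (Fin n)) (c : ℝ≥0), 2 ≤ #S ∧ (∀ i ∈ S, c ≤ v i) ∧ (∀ i ∉ S, v i ≤ c) ∧
      F2 n v = #S * c := by
  rcases (univ.filter fun j : Fin n => 2 ≤ (j : ℕ) + 1).eq_empty_or_nonempty with he | hne
  · exact absurd (by rw [F2, he, Finset.sup_empty]; rfl) h
  · obtain ⟨j, hj, heq⟩ := Finset.exists_mem_eq_sup _ hne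
      fun j => ((j : ℕ) + 1 : ℝ≥0) * sortedDesc v j
    obtain ⟨S, hcard, hS, hS'⟩ := exists_top_set v j
    refine ⟨S, sortedDesc v j, ?_, hS, hS', ?_⟩
    · rw [hcard]; exact (Finset.mem_filter.1 hj).2
    · rw [hcard, F2, heq]; push_cast; rfl

theorem card_mul_le_F2 {n : ℕ} {v : Fin n → ℝ≥0} {S : Finset (Fin n)} {c : ℝ≥0}
    (hS : ∀ i ∈ S, c ≤ v i) (h2 : 2 ≤ #S) : #S * c ≤ F2 n v := by
  have hn : #S ≤ n := by simpa using Finset.card_le_univ S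
  have h := Finset.le_sup (s := univ.filter fun j : Fin n => 2 ≤ (j : ℕ) + 1)
    (f := fun j => ((j : ℕ) + 1 : ℝ≥0) * sortedDesc v j) (b := ⟨#S - 1, by omega⟩)
    (by simp; omega)
  refine le_trans ?_ h
  have hcast : ((#S - 1 : ℕ) : ℝ≥0) + 1 = #S := by
    have : #S - 1 + 1 = #S := by omega
    exact_mod_cast this
  simp only [hcast]
  gcongr
  exact le_sortedDesc hS (show #S - 1 < #S by omega)

theorem exists_maxV_eq {n : ℕ} (v : Fin n → ℝ≥0) (h : maxV n v ≠ 0) :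
    ∃ (S : Finset (Fin n)) (c : ℝ≥0), 2 ≤ #S ∧ (∀ i ∈ S, c ≤ v i) ∧
      maxV n v = (#S - 1 : ℕ) * c := by
  rcases (univ : Finset (Fin n)).eq_empty_or_nonempty with he | hne
  · exact absurd (by rw [maxV, he, Finset.sup_empty]; rfl) h
  · obtain ⟨j, -, heq⟩ := Finset.exists_mem_eq_sup _ hne
      fun j : Fin n => ((j : ℕ) : ℝ≥0) * sortedDesc v j
    obtain ⟨S, hcard, hS, -⟩ := exists_top_set v j
    rw [← maxV] at heq
    refine ⟨S, sortedDesc v j, ?_, hS, ?_⟩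
    · have : (j : ℕ) ≠ 0 := by
        intro h0
        rw [heq, h0] at h
        simp at h
      omega
    · rw [hcard, heq]; simp

theorem card_sub_one_mul_le_maxV {n : ℕ} {v : Fin n → ℝ≥0} {S : Finset (Fin n)} {c : ℝ≥0}
    (hS : ∀ i ∈ S, c ≤ v i) (h2 : 2 ≤ #S) : (#S - 1 : ℕ) * c ≤ maxV n v := by
  have hn : #S ≤ n := by simpa using Finset.card_le_univ S
  refine le_trans ?_ (Finset.le_sup (mem_univ (⟨#S - 1, by omega⟩ : Fin n)))
  gcongr
  exact le_sortedDesc hS (show #S - 1 < #S by omega)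

theorem IsRobust.mono {rev : (n : ℕ) → (Fin n → ℝ≥0) → (Fin n → ℝ≥0) → ℝ} {α α' : ℝ}
    {f : Benchmark} (h : IsRobust rev α f) (hα : 0 < α) (hαα' : α ≤ α') : IsRobust rev α' f :=
  fun n vhat v => le_trans (by gcongr) (h n vhat v)

/-! ### Mistaken predictions -/

open Classical in
/-- The bidders other than `i` whose bids differ from their predictions. -/
def mistakes {n : ℕ} (vhat b : Fin n → ℝ≥0) (i : Fin n) : Finset (Fin n) :=
  {k | k ≠ i ∧ b k ≠ vhat k}

/-- Some bidder other than `i` has a mistaken prediction and a highest bid among those. -/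
def SeesTop {n : ℕ} (vhat b : Fin n → ℝ≥0) (i : Fin n) : Prop :=
  ∃ k, k ≠ i ∧ b k ≠ vhat k ∧ ∀ l ≠ i, b l ≤ b k

section

variable {n : ℕ} (vhat b : Fin n → ℝ≥0) (i : Fin n)

theorem mistakes_update (z : ℝ≥0) :
    mistakes vhat (Function.update b i z) i = mistakes vhat b i := by
  classical
  refine Finset.filter_congr fun k _ => and_congr_right fun hk => ?_
  rw [Function.update_of_ne hk]

theorem seesTop_update (z : ℝ≥0) :
    SeesTop vhat (Function.update b i z) i ↔ SeesTop vhat b i := by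
  refine exists_congr fun k => and_congr_right fun hk => ?_
  rw [Function.update_of_ne hk]
  refine and_congr_right fun _ => forall₂_congr fun l hl => ?_
  rw [Function.update_of_ne hl]

theorem card_mistakes_comp_perm (σ : Equiv.Perm (Fin n)) :
    #(mistakes (vhat ∘ σ) (b ∘ σ) i) = #(mistakes vhat b (σ i)) := by
  classical
  have := card_filter_comp_perm σ fun k => k ≠ σ i ∧ b k ≠ vhat k
  rw [mistakes, mistakes, ← this]
  simp

theorem seesTop_comp_perm (σ : Equiv.Perm (Fin n)) :
    SeesTop (vhat ∘ σ) (b ∘ σ) i ↔ SeesTop vhat b (σ i) := by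
  refine (σ.exists_congr_left).trans (exists_congr fun k => ?_)
  rw [σ.forall_congr_left]
  simp [Equiv.symm_apply_eq]

theorem mistakes_self : mistakes b b i = ∅ := by
  simp [mistakes]

end

/-! ### A mechanism that competes with `maxV` -/

open Classical in
/-- Follow the prediction as long as no mistake is seen, and in `3` out of `11` cases otherwise. -/
def maxVRule : MixRule 11 where
  pred _ vhat b i := if #(mistakes vhat b i) = 0 then 11 else 3
  vick _ _ _ _ := 0
  add_le _ _ _ _ := by split_ifs <;> simp
  pred_update _ _ _ _ _ := by rw [mistakes_update]
  vick_update _ _ _ _ _ := rfl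
  pred_comp_perm _ _ _ _ _ := by rw [card_mistakes_comp_perm]
  vick_comp_perm _ _ _ _ _ := rfl

theorem three_mul_le_maxVRule_totalPay {n : ℕ} {vhat v : Fin n → ℝ≥0} {i : Fin n}
    (h : v i = vhat i) : 2 ^ n * (3 * v i) ≤ maxVRule.totalPay 2 vhat v i := by
  rw [MixRule.totalPay_eq, add_assoc]
  refine le_add_right ?_
  rw [h, postedPay_of_le le_rfl]
  push_cast
  gcongr
  simp only [maxVRule]
  split_ifs <;> norm_num

theorem eight_mul_le_maxVRule_totalPay {n : ℕ} {vhat v : Fin n → ℝ≥0} {i : Fin n}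
    (h : #(mistakes vhat v i) ≠ 0) :
    8 * ∑ s : Fin n → Fin 2, samplePay v s i ≤ maxVRule.totalPay 2 vhat v i := by
  rw [MixRule.totalPay_eq]
  refine le_add_left (le_of_eq ?_)
  simp [maxVRule, h, -Finset.card_eq_zero]

/-- If everybody sees a mistake, sampling has weight at least 8/11 and earns 3/8 of the benchmark.
If some `k` sees none, all others are predicted correctly and pay their values with weight at least
3/11. The possible loss of `k` is covered because the benchmark counts only `#S - 1` bidders. -/
theorem maxVRule_isRobust : IsRobust (maxVRule.mechanism 2).revenue (11 / 3) maxV := by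
  intro n vhat v
  rw [MixRule.mechanism_revenue]
  suffices h : 3 * 2 ^ n * maxV n v ≤ ∑ i, maxVRule.totalPay 2 vhat v i by
    have h' : 3 * 2 ^ n * (maxV n v : ℝ) ≤ ∑ i, (maxVRule.totalPay 2 vhat v i : ℝ) := by
      exact_mod_cast h
    rw [div_le_div_iff₀ (by norm_num) (by positivity)]
    push_cast
    nlinarith [h']
  rcases eq_or_ne (maxV n v) 0 with h0 | h0
  · rw [h0, mul_zero]; exact zero_le
  obtain ⟨S, c, h2, hS, hmax⟩ := exists_maxV_eq v h0
  rw [hmax]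
  by_cases hall : ∀ i, #(mistakes vhat v i) ≠ 0
  · calc 3 * 2 ^ n * ((#S - 1 : ℕ) * c) = 3 * (#S - 1 : ℕ) * c * 2 ^ n := by ring
      _ ≤ 8 * ∑ i, ∑ s : Fin n → Fin 2, samplePay v s i := sum_samplePay_two_ge hS h2
      _ = ∑ i, 8 * ∑ s : Fin n → Fin 2, samplePay v s i := Finset.mul_sum _ _ _
      _ ≤ _ := Finset.sum_le_sum fun i _ => eight_mul_le_maxVRule_totalPay (hall i)
  · push Not at hall
    obtain ⟨k, hk⟩ := hall
    have hcorrect : ∀ i ≠ k, v i = vhat i := by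
      intro i hi
      by_contra hne
      rw [Finset.card_eq_zero] at hk
      have : i ∈ mistakes vhat v k := by simp [mistakes, hi, hne]
      simp [hk] at this
    calc 3 * 2 ^ n * ((#S - 1 : ℕ) * c) ≤ 3 * 2 ^ n * (#(S.erase k) * c) := by
          gcongr
          exact Finset.pred_card_le_card_erase
      _ = ∑ i ∈ S.erase k, 2 ^ n * (3 * c) := by
          rw [Finset.sum_const, nsmul_eq_mul]; ring
      _ ≤ ∑ i ∈ S.erase k, maxVRule.totalPay 2 vhat v i := by
          refine Finset.sum_le_sum fun i hi => le_trans ?_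
            (three_mul_le_maxVRule_totalPay (hcorrect i (Finset.ne_of_mem_erase hi)))
          gcongr
          exact hS i (Finset.mem_of_mem_erase hi)
      _ ≤ _ := Finset.sum_le_sum_of_subset (Finset.subset_univ _)

/-- Here `β = 1 / 2`, since `#S - 1 ≥ #S / 2` when `#S ≥ 2`. The loss of the first arrival costs
nothing more, as the benchmark itself is `(#S - 1) c`. -/
theorem maxVRule_online_isRobust :
    IsRobust (maxVRule.online 2).revenue (2 * (11 / 3)) maxV := by
  refine MixRule.online_isRobust (β := 1 / 2) maxVRule (by norm_num) (by norm_num)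
    maxVRule_isRobust (fun n v S c hS h2 => ?_) fun n v => ?_
  · have h : ((#S - 1 : ℕ) : ℝ) * c ≤ maxV n v := by
      exact_mod_cast card_sub_one_mul_le_maxV hS h2
    refine le_trans (mul_le_mul_of_nonneg_right ?_ c.2) h
    rw [Nat.cast_sub (by omega)]
    have : (2 : ℝ) ≤ #S := by exact_mod_cast h2
    push_cast
    linarith
  · rcases eq_or_ne (maxV n v) 0 with h0 | h0
    · exact ⟨∅, 0, by simp, by simp [h0]⟩
    · obtain ⟨S, c, -, hS, hmax⟩ := exists_maxV_eq v h0
      refine ⟨S, c, hS, le_of_eq ?_⟩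
      rw [hmax, NNReal.coe_mul, NNReal.coe_natCast]
      ring

theorem exists_mechanism_maxV :
    ∃ (M : Mechanism) (hM : M.Truthful),
      IsConsistent M.revenue 1 OPT ∧ IsRobust M.revenue (Real.exp 1 + 1) maxV ∧
      (OSAP M hM).Truthful ∧ IsConsistent (OSAP M hM).revenue 1 OPT ∧
      IsRobust (OSAP M hM).revenue (2 * (Real.exp 1 + 1)) maxV := by
  have hcons : ∀ n v i, maxVRule.pred n v v i = 11 := by
    intro n v i
    simp [maxVRule, mistakes_self]
  have he : 11 / 3 ≤ Real.exp 1 + 1 := by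
    have := Real.exp_one_gt_d9
    linarith
  exact ⟨maxVRule.mechanism 2, maxVRule.mechanism_truthful, MixRule.mechanism_isConsistent hcons,
    maxVRule_isRobust.mono (by norm_num) he, OnlineMechanism.truthful _,
    MixRule.online_isConsistent hcons,
    maxVRule_online_isRobust.mono (by norm_num) (by linarith)⟩

/-! ### A mechanism that competes with `F2` -/

open Classical in
/-- Follow the prediction as long as no mistake is seen. If the only mistake that is seen is at a
highest bid, offer the prediction or the highest other bid. In the other cases give also random
sampling a chance. -/
def fTwoRule : MixRule 221 where
  -- The total 221 = 50 + 171 gives sampling the weight 171, which by the bound 50/171 earns as much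
  -- as predictions of weight 50. Where the highest other bid gets weight 50, sampling keeps 121;
  -- with a top mistake in sight the weights 100 + 121 exhaust the total.
  pred _ vhat b i := if #(mistakes vhat b i) = 0 then 221
    else if #(mistakes vhat b i) = 1 ∧ SeesTop vhat b i then 100 else 50
  vick _ vhat b i := if #(mistakes vhat b i) = 1 then (if SeesTop vhat b i then 121 else 50) else 0
  add_le _ vhat b i := by split_ifs <;> simp_all
  pred_update _ _ _ _ _ := by simp only [mistakes_update, seesTop_update]
  vick_update _ _ _ _ _ := by simp only [mistakes_update, seesTop_update]
  pred_comp_perm _ _ _ _ _ := by simp only [card_mistakes_comp_perm, seesTop_comp_perm]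
  vick_comp_perm _ _ _ _ _ := by simp only [card_mistakes_comp_perm, seesTop_comp_perm]

section

variable {n : ℕ} {vhat v : Fin n → ℝ≥0} {i : Fin n}

/-- The payments to random sampling, summed over all colourings. -/
def sampleTotal (v : Fin n → ℝ≥0) (i : Fin n) : ℝ≥0 := ∑ s : Fin n → Fin 3, samplePay v s i

theorem fTwoRule_totalPay_eq (vhat v : Fin n → ℝ≥0) (i : Fin n) :
    (fTwoRule.totalPay 3 vhat v i : ℝ) =
      3 ^ n * (fTwoRule.pred n vhat v i * (postedPay (vhat i) (v i) : ℝ)) +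
      3 ^ n * (fTwoRule.vick n vhat v i * (postedPay (vickPrice v i) (v i) : ℝ)) +
      (221 - fTwoRule.pred n vhat v i - fTwoRule.vick n vhat v i : ℕ) * (sampleTotal v i : ℝ) := by
  rw [MixRule.totalPay_eq, ← sampleTotal]
  simp only [NNReal.coe_add, NNReal.coe_mul, NNReal.coe_pow, NNReal.coe_natCast, Nat.cast_ofNat,
    NNReal.coe_ofNat]

theorem fTwoRule_totalPay_ge_of_correct (h : v i = vhat i) :
    3 ^ n * (50 * (v i : ℝ)) ≤ fTwoRule.totalPay 3 vhat v i := by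
  rw [fTwoRule_totalPay_eq, add_assoc]
  refine le_add_of_le_of_nonneg ?_ (by positivity)
  rw [h, postedPay_of_le le_rfl]
  gcongr
  simp only [fTwoRule]
  split_ifs <;> norm_num

theorem fTwoRule_totalPay_ge_of_correct_of_seesTop (h : v i = vhat i)
    (hcard : #(mistakes vhat v i) = 1) (ht : SeesTop vhat v i) :
    3 ^ n * (100 * (v i : ℝ)) ≤ fTwoRule.totalPay 3 vhat v i := by
  rw [fTwoRule_totalPay_eq, add_assoc]
  refine le_add_of_le_of_nonneg ?_ (by positivity)
  rw [h, postedPay_of_le le_rfl]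
  simp [fTwoRule, hcard, ht, -Finset.card_eq_zero]

theorem fTwoRule_totalPay_ge_of_seesTop
    (hcard : #(mistakes vhat v i) = 1) (ht : SeesTop vhat v i) :
    3 ^ n * (121 * (postedPay (vickPrice v i) (v i) : ℝ)) ≤ fTwoRule.totalPay 3 vhat v i := by
  rw [fTwoRule_totalPay_eq]
  simp only [fTwoRule, hcard, ht]
  simp

theorem fTwoRule_totalPay_ge_of_not_seesTop
    (hcard : #(mistakes vhat v i) = 1) (ht : ¬ SeesTop vhat v i) :
    3 ^ n * (50 * (postedPay (vickPrice v i) (v i) : ℝ)) + 121 * sampleTotal v i ≤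
      fTwoRule.totalPay 3 vhat v i := by
  rw [fTwoRule_totalPay_eq]
  simp only [fTwoRule, hcard, ht]
  simp

theorem fTwoRule_totalPay_ge_of_correct_of_not_seesTop (h : v i = vhat i)
    (hcard : #(mistakes vhat v i) = 1) (ht : ¬ SeesTop vhat v i) :
    3 ^ n * (50 * (v i : ℝ)) + 3 ^ n * (50 * (postedPay (vickPrice v i) (v i) : ℝ)) ≤
      fTwoRule.totalPay 3 vhat v i := by
  rw [fTwoRule_totalPay_eq, h, postedPay_of_le (le_refl (vhat i)), ← h]
  simp only [fTwoRule, hcard, ht]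
  simp

theorem fTwoRule_totalPay_ge_of_two_le (hcard : 2 ≤ #(mistakes vhat v i)) :
    171 * (sampleTotal v i : ℝ) ≤ fTwoRule.totalPay 3 vhat v i := by
  rw [fTwoRule_totalPay_eq]
  refine le_add_of_nonneg_of_le (by positivity) (le_of_eq ?_)
  simp [fTwoRule, show #(mistakes vhat v i) ≠ 0 by omega, show #(mistakes vhat v i) ≠ 1 by omega,
    -Finset.card_eq_zero]

theorem fTwoRule_totalPay_ge_of_correct_of_two_le (h : v i = vhat i)
    (hcard : 2 ≤ #(mistakes vhat v i)) :
    3 ^ n * (50 * (v i : ℝ)) + 171 * (sampleTotal v i : ℝ) ≤ fTwoRule.totalPay 3 vhat v i := by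
  rw [fTwoRule_totalPay_eq, h, postedPay_of_le (le_refl (vhat i)), ← h]
  simp [fTwoRule, show #(mistakes vhat v i) ≠ 0 by omega, show #(mistakes vhat v i) ≠ 1 by omega,
    -Finset.card_eq_zero]

theorem le_postedPay_vickPrice {c : ℝ≥0} {j : Fin n} (hj : j ≠ i) (hc : c ≤ v j)
    (hmax : ∀ l, v l ≤ v i) : c ≤ postedPay (vickPrice v i) (v i) := by
  rw [postedPay_of_le (show vickPrice v i ≤ v i from Finset.sup_le fun l _ => hmax l)]
  exact hc.trans (Finset.le_sup (Finset.mem_erase.2 ⟨hj, mem_univ j⟩))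

theorem sampleTotal_le_sum_erase {j k : Fin n} (h : v k < v j) :
    sampleTotal v k ≤ ∑ i ∈ univ.erase k, sampleTotal v i := by
  unfold sampleTotal
  rw [Finset.sum_comm]
  exact Finset.sum_le_sum fun s _ => samplePay_le_sum_erase h s

end

/-! ### The revenue against `F2`, by the number of mistakes -/

theorem card_sdiff_mul_add_sum_le {n : ℕ} {S E : Finset (Fin n)} {C : ℝ} {x w : Fin n → ℝ}
    (hSE : ∀ i ∈ S, i ∉ E → C + x i ≤ w i) (h : ∀ i, x i ≤ w i) :
    #(S \ E) * C + ∑ i, x i ≤ ∑ i, w i := by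
  have h1 : (#(S \ E) : ℝ) * C = ∑ i, if i ∈ S \ E then C else 0 := by
    rw [Finset.sum_ite_mem, Finset.univ_inter, Finset.sum_const, nsmul_eq_mul]
  rw [h1, ← Finset.sum_add_distrib]
  refine Finset.sum_le_sum fun i _ => ?_
  split_ifs with hi
  · exact hSE i (Finset.mem_sdiff.1 hi).1 (Finset.mem_sdiff.1 hi).2
  · rw [zero_add]; exact h i

section

variable {n : ℕ} {vhat v : Fin n → ℝ≥0} {S E : Finset (Fin n)} {c : ℝ≥0}

theorem mistakes_eq_erase (hE : ∀ i, i ∈ E ↔ v i ≠ vhat i) (i : Fin n) :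
    mistakes vhat v i = E.erase i := by
  ext k
  simp [mistakes, hE]

/-- With few mistakes in `S`, it suffices that one bidder pays in addition. -/
theorem fTwoRule_revenue_ge_of_extra {i₀ : Fin n} {C y : ℝ}
    (hSE : ∀ i ∈ S, i ∉ E → C ≤ fTwoRule.totalPay 3 vhat v i)
    (hi₀ : y ≤ fTwoRule.totalPay 3 vhat v i₀)
    (hi₀' : i₀ ∈ S → i₀ ∉ E → C + y ≤ fTwoRule.totalPay 3 vhat v i₀) :
    #(S \ E) * C + y ≤ ∑ i, (fTwoRule.totalPay 3 vhat v i : ℝ) := by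
  have h := card_sdiff_mul_add_sum_le (S := S) (E := E) (C := C) (x := Pi.single i₀ y)
    (w := fun i => (fTwoRule.totalPay 3 vhat v i : ℝ)) (fun i hi hiE => ?_) (fun i => ?_)
  · simpa using h
  · by_cases hii : i = i₀
    · subst hii; simpa using hi₀' hi hiE
    · simpa [hii] using hSE i hi hiE
  · by_cases hii : i = i₀
    · subst hii; simpa using hi₀
    · simp [hii]

/-- Correctly predicted bidders of `S` pay at least `50 c` each, so only a mistaken `k` in `S` has
to be made up for. Either another bidder of `S` sees `k` at the top and pays its prediction with
weight 100, or the highest bidder is not `k` and pays in addition a second price, which is at least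
`v k ≥ c`. -/
theorem fTwoRule_revenue_ge_of_card_le_one (hS : ∀ i ∈ S, c ≤ v i) (hS' : ∀ i ∉ S, v i ≤ c)
    (h2 : 2 ≤ #S) (hE : ∀ i, i ∈ E ↔ v i ≠ vhat i) (hcard : #E ≤ 1) :
    #S * (3 ^ n * (50 * (c : ℝ))) ≤ ∑ i, (fTwoRule.totalPay 3 vhat v i : ℝ) := by
  have hcorrect : ∀ i, i ∉ E → v i = vhat i := fun i hi => not_not.1 fun h => hi ((hE i).2 h)
  have hc : ∀ i ∈ S, (c : ℝ) ≤ v i := fun i hi => by exact_mod_cast hS i hi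
  have hbase : ∀ i ∈ S, i ∉ E →
      (3 : ℝ) ^ n * (50 * c) ≤ fTwoRule.totalPay 3 vhat v i := fun i hi hiE => by
    refine le_trans ?_ (fTwoRule_totalPay_ge_of_correct (hcorrect i hiE))
    have := hc i hi
    gcongr
  rcases le_or_gt #S #(S \ E) with hd | hd
  · have h := card_sdiff_mul_add_sum_le (S := S) (E := E) (C := 3 ^ n * (50 * (c : ℝ)))
      (x := 0) (w := fun i => (fTwoRule.totalPay 3 vhat v i : ℝ))
      (fun i hi hiE => by simpa using hbase i hi hiE) (fun i => by simp)
    refine le_trans ?_ h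
    simp only [Pi.zero_apply, Finset.sum_const_zero, add_zero]
    gcongr
  obtain ⟨k, rfl⟩ : ∃ k, E = {k} := by
    rw [← Finset.card_eq_one]
    refine le_antisymm hcard (Finset.card_pos.2 (Finset.nonempty_iff_ne_empty.2 ?_))
    rintro rfl
    simp at hd
  have hkS : k ∈ S := by
    by_contra hk
    rw [Finset.sdiff_singleton_eq_erase, Finset.erase_eq_of_notMem hk] at hd
    exact lt_irrefl _ hd
  have hcardE : (#(S \ {k}) : ℝ) + 1 = #S := by
    rw [Finset.sdiff_singleton_eq_erase]
    exact_mod_cast Finset.card_erase_add_one hkS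
  have hmist : ∀ i ≠ k, #(mistakes vhat v i) = 1 := by
    intro i hi
    rw [mistakes_eq_erase hE, Finset.erase_eq_of_notMem (by simpa using hi),
      Finset.card_singleton]
  suffices hextra : ∃ i ∈ S, i ≠ k ∧
      (3 : ℝ) ^ n * (50 * c) + 3 ^ n * (50 * c) ≤ fTwoRule.totalPay 3 vhat v i by
    obtain ⟨i, hi, hik, hle⟩ := hextra
    have h := fTwoRule_revenue_ge_of_extra (S := S) (E := {k}) (i₀ := i)
      (C := 3 ^ n * (50 * c)) (y := 3 ^ n * (50 * c)) hbase
      (hbase i hi (by simpa using hik)) fun _ _ => hle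
    refine le_trans (le_of_eq ?_) h
    rw [← hcardE]
    ring
  by_cases htop : ∃ i ∈ S, i ≠ k ∧ SeesTop vhat v i
  · obtain ⟨i, hi, hik, ht⟩ := htop
    refine ⟨i, hi, hik, le_trans ?_ (fTwoRule_totalPay_ge_of_correct_of_seesTop
      (hcorrect i (by simpa using hik)) (hmist i hik) ht)⟩
    have : (3 : ℝ) ^ n * (100 * c) ≤ 3 ^ n * (100 * v i) := by
      have := hc i hi
      gcongr
    linarith
  · push Not at htop
    obtain ⟨t, ht, htmax⟩ := Finset.exists_max_image S v ⟨k, hkS⟩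
    have hmax : ∀ l, v l ≤ v t := fun l => by
      by_cases hl : l ∈ S
      · exact htmax l hl
      · exact (hS' l hl).trans (hS t ht)
    have htk : t ≠ k := by
      rintro rfl
      obtain ⟨i, hi, hit⟩ := Finset.exists_mem_ne h2 t
      exact htop i hi hit ⟨t, hit.symm, (hE t).1 (by simp), fun l _ => hmax l⟩
    refine ⟨t, ht, htk, le_trans ?_ (fTwoRule_totalPay_ge_of_correct_of_not_seesTop
      (hcorrect t (by simpa using htk)) (hmist t htk) (htop t ht htk))⟩
    have h1 := hc t ht
    have h2 : (c : ℝ) ≤ postedPay (vickPrice v t) (v t) := by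
      exact_mod_cast le_postedPay_vickPrice htk.symm (hS k hkS) hmax
    gcongr

theorem sum_sampleTotal_ge (hS : ∀ i ∈ S, c ≤ v i) (h2 : 2 ≤ #S) :
    50 * #S * c * 3 ^ n ≤ 171 * ∑ i, (sampleTotal v i : ℝ) := by
  exact_mod_cast sum_samplePay_three_ge hS h2

/-- Two mistakes, one of which is seen as a top one: the other one has the highest value. -/
theorem fTwoRule_revenue_ge_of_seesTop_of_not_seesTop (hS : ∀ i ∈ S, c ≤ v i)
    (hS' : ∀ i ∉ S, v i ≤ c) (h2 : 2 ≤ #S) {j k : Fin n} (hjk : j ≠ k)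
    (hE : ∀ i, i ∈ ({j, k} : Finset (Fin n)) ↔ v i ≠ vhat i)
    (hk : SeesTop vhat v k) (hj : ¬ SeesTop vhat v j) :
    #S * (3 ^ n * (50 * (c : ℝ))) ≤ ∑ i, (fTwoRule.totalPay 3 vhat v i : ℝ) := by
  have hcorrect : ∀ i, i ∉ ({j, k} : Finset (Fin n)) → v i = vhat i :=
    fun i hi => not_not.1 fun h => hi ((hE i).2 h)
  have hc : ∀ i ∈ S, (c : ℝ) ≤ v i := fun i hi => by exact_mod_cast hS i hi
  have hkmax : ∀ l ≠ k, v l ≤ v j := by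
    obtain ⟨j', hj'k, hj', hmax⟩ := hk
    have : j' = j := by
      have := (hE j').2 hj'
      simpa [hj'k] using this
    rwa [this] at hmax
  -- As `j` does not see `k` at the top, some third bidder beats `k`.
  obtain ⟨l, hlj, hkl⟩ : ∃ l ≠ j, v k < v l := by
    by_contra! h
    exact hj ⟨k, hjk.symm, (hE k).1 (by simp), fun l hl => h l hl⟩
  have hlk : l ≠ k := by rintro rfl; exact lt_irrefl _ hkl
  have hkj : v k < v j := hkl.trans_le (hkmax l hlk)
  have hjmax : ∀ i, v i ≤ v j := fun i => by
    by_cases hi : i = k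
    · rw [hi]; exact hkj.le
    · exact hkmax i hi
  have hmistj : #(mistakes vhat v j) = 1 := by
    rw [mistakes_eq_erase hE, Finset.erase_insert (by simpa using hjk), Finset.card_singleton]
  have hvick : (c : ℝ) ≤ postedPay (vickPrice v j) (v j) := by
    obtain ⟨i, hi, hij⟩ := Finset.exists_mem_ne h2 j
    exact_mod_cast le_postedPay_vickPrice hij (hS i hi) hjmax
  have hmist : ∀ i, i ∉ ({j, k} : Finset (Fin n)) → 2 ≤ #(mistakes vhat v i) := by
    intro i hi
    rw [mistakes_eq_erase hE, Finset.erase_eq_of_notMem hi, Finset.card_pair hjk]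
  have hpayj := fTwoRule_totalPay_ge_of_not_seesTop hmistj hj
  set P : ℝ := 3 ^ n with hP
  have hP0 : 0 < P := by positivity
  -- The loss of `j` is repaid by its second price with weight 50. For the loss of `k` there is the
  -- sampling revenue with weight 121, without the part of `k`, who gets no sampling.
  have hsum := card_sdiff_mul_add_sum_le (S := S) (E := {j, k}) (C := P * (50 * c))
    (x := fun i => (if i = j then P * (50 * c) else 0) +
      if i = k then 0 else 121 * (sampleTotal v i : ℝ))
    (w := fun i => (fTwoRule.totalPay 3 vhat v i : ℝ)) (fun i hi hiE => ?_) (fun i => ?_)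
  · have hsplit : ∑ i, ((if i = j then P * (50 * (c : ℝ)) else 0) +
        if i = k then 0 else 121 * (sampleTotal v i : ℝ)) =
        P * (50 * c) + 121 * ∑ i ∈ univ.erase k, (sampleTotal v i : ℝ) := by
      rw [Finset.sum_add_distrib, Finset.sum_ite_eq' univ j, if_pos (mem_univ j),
        ← Finset.add_sum_erase univ _ (mem_univ k), if_pos rfl, zero_add, Finset.mul_sum]
      congr 1
      exact Finset.sum_congr rfl fun i hi => by rw [if_neg (Finset.ne_of_mem_erase hi)]
    rw [hsplit] at hsum
    refine le_trans ?_ hsum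
    have hnn : (0 : ℝ) ≤ ∑ i ∈ univ.erase k, (sampleTotal v i : ℝ) := by positivity
    have hCc : 0 ≤ P * (50 * (c : ℝ)) := by positivity
    by_cases hsub : {j, k} ⊆ S
    · have h3 : 3 ≤ #S := by
        by_contra h3
        have heq : ({j, k} : Finset (Fin n)) = S := by
          refine Finset.eq_of_subset_of_card_le hsub ?_
          rw [Finset.card_pair hjk]; omega
        have hl : l ∉ S := by rw [← heq]; simp [hlj, hlk]
        exact absurd ((hS' l hl).trans (hS k (hsub (by simp)))) hkl.not_ge
      have hcardE : (#(S \ {j, k}) : ℝ) + 2 = #S := by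
        have := Finset.card_sdiff_add_card_eq_card hsub
        rw [Finset.card_pair hjk] at this
        exact_mod_cast this
      have hV := sum_sampleTotal_ge hS h2
      -- Without `k` at least half of the sampling revenue remains. With `#S ≥ 3` this suffices,
      -- since 121 * (50 * 3 / 171) / 2 > 50.
      have hhalf : (sampleTotal v k : ℝ) ≤ ∑ i ∈ univ.erase k, (sampleTotal v i : ℝ) := by
        exact_mod_cast sampleTotal_le_sum_erase hkj
      rw [← Finset.add_sum_erase univ _ (mem_univ k)] at hV
      have h3' : (3 : ℝ) ≤ #S := by exact_mod_cast h3
      have h4 : 3 * (P * (50 * c)) ≤ #S * (P * (50 * (c : ℝ))) := by gcongr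
      rw [← hcardE] at h4 hV ⊢
      rw [← hP] at hV
      nlinarith
    · have hcardE : (#S : ℝ) ≤ #(S \ {j, k}) + 1 := by
        have h1 := Finset.card_sdiff_add_card_inter S {j, k}
        have h5 : #(S ∩ {j, k}) < 2 := by
          rw [← Finset.card_pair hjk]
          refine Finset.card_lt_card ⟨Finset.inter_subset_right, fun h => hsub ?_⟩
          exact fun i hi => Finset.mem_of_mem_inter_left (h hi)
        have : #S ≤ #(S \ {j, k}) + 1 := by omega
        exact_mod_cast this
      nlinarith
  · have h1 := fTwoRule_totalPay_ge_of_correct_of_two_le (hcorrect i hiE) (hmist i hiE)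
    simp only [Finset.mem_insert, Finset.mem_singleton, not_or] at hiE
    rw [if_neg hiE.1, if_neg hiE.2]
    have h6 : P * (50 * (c : ℝ)) ≤ P * (50 * v i) := by
      have := hc i hi
      gcongr
    have h7 : (0 : ℝ) ≤ sampleTotal v i := NNReal.coe_nonneg _
    linarith
  · by_cases hij : i = j
    · subst hij
      rw [if_pos rfl, if_neg hjk]
      refine le_trans ?_ hpayj
      gcongr
    · rw [if_neg hij, zero_add]
      split_ifs with hik
      · exact NNReal.coe_nonneg _
      · have h7 : (0 : ℝ) ≤ sampleTotal v i := NNReal.coe_nonneg _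
        have h8 := fTwoRule_totalPay_ge_of_two_le (hmist i (by simp [hij, hik]))
        linarith

/-- Two mistakes, both of which are seen as top ones: these have the highest two values. -/
theorem fTwoRule_revenue_ge_of_seesTop_of_seesTop (hS : ∀ i ∈ S, c ≤ v i)
    (h2 : 2 ≤ #S) {j k : Fin n} (hjk : j ≠ k)
    (hE : ∀ i, i ∈ ({j, k} : Finset (Fin n)) ↔ v i ≠ vhat i)
    (hk : SeesTop vhat v k) (hj : SeesTop vhat v j) (hle : v k ≤ v j) :
    #S * (3 ^ n * (50 * (c : ℝ))) ≤ ∑ i, (fTwoRule.totalPay 3 vhat v i : ℝ) := by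
  have hcorrect : ∀ i, i ∉ ({j, k} : Finset (Fin n)) → v i = vhat i :=
    fun i hi => not_not.1 fun h => hi ((hE i).2 h)
  have hc : ∀ i ∈ S, (c : ℝ) ≤ v i := fun i hi => by exact_mod_cast hS i hi
  have hkmax : ∀ l ≠ k, v l ≤ v j := by
    obtain ⟨j', hj'k, hj', hmax⟩ := hk
    have : j' = j := by
      have := (hE j').2 hj'
      simpa [hj'k] using this
    rwa [this] at hmax
  have hjmax : ∀ i, v i ≤ v j := fun i => by
    by_cases hi : i = k
    · rw [hi]; exact hle
    · exact hkmax i hi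
  have hmistj : #(mistakes vhat v j) = 1 := by
    rw [mistakes_eq_erase hE, Finset.erase_insert (by simpa using hjk), Finset.card_singleton]
  have hvick : (c : ℝ) ≤ postedPay (vickPrice v j) (v j) := by
    obtain ⟨i, hi, hij⟩ := Finset.exists_mem_ne h2 j
    exact_mod_cast le_postedPay_vickPrice hij (hS i hi) hjmax
  have hpayj := fTwoRule_totalPay_ge_of_seesTop hmistj hj
  have hbase : ∀ i ∈ S, i ∉ ({j, k} : Finset (Fin n)) →
      (3 : ℝ) ^ n * (50 * c) ≤ fTwoRule.totalPay 3 vhat v i := fun i hi hiE => by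
    refine le_trans ?_ (fTwoRule_totalPay_ge_of_correct (hcorrect i hiE))
    have := hc i hi
    gcongr
  -- The second price paid by `j` with weight 121 exceeds the 2 * 50 lost with both mistaken
  -- bidders.
  have h := fTwoRule_revenue_ge_of_extra (S := S) (E := {j, k}) (i₀ := j)
    (C := 3 ^ n * (50 * (c : ℝ))) (y := 3 ^ n * (121 * (c : ℝ))) hbase
    (le_trans (by gcongr) hpayj) fun _ hjE => absurd (by simp) hjE
  refine le_trans ?_ h
  have hcardE : (#S : ℝ) ≤ #(S \ {j, k}) + 2 := by
    have h1 := Finset.le_card_sdiff {j, k} S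
    rw [Finset.card_pair hjk] at h1
    have : #S ≤ #(S \ {j, k}) + 2 := by omega
    exact_mod_cast this
  have hP0 : (0 : ℝ) ≤ 3 ^ n * c := by positivity
  nlinarith

/-- Two mistakes, none of which is seen as a top one. -/
theorem fTwoRule_revenue_ge_of_not_seesTop_of_not_seesTop (hS : ∀ i ∈ S, c ≤ v i)
    (hS' : ∀ i ∉ S, v i ≤ c) (h2 : 2 ≤ #S) {j k : Fin n} (hjk : j ≠ k)
    (hE : ∀ i, i ∈ ({j, k} : Finset (Fin n)) ↔ v i ≠ vhat i)
    (hk : ¬ SeesTop vhat v k) (hj : ¬ SeesTop vhat v j) :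
    #S * (3 ^ n * (50 * (c : ℝ))) ≤ ∑ i, (fTwoRule.totalPay 3 vhat v i : ℝ) := by
  have hcorrect : ∀ i, i ∉ ({j, k} : Finset (Fin n)) → v i = vhat i :=
    fun i hi => not_not.1 fun h => hi ((hE i).2 h)
  have hmist : ∀ i, i ∉ ({j, k} : Finset (Fin n)) → 2 ≤ #(mistakes vhat v i) := by
    intro i hi
    rw [mistakes_eq_erase hE, Finset.erase_eq_of_notMem hi, Finset.card_pair hjk]
  have hmistj : #(mistakes vhat v j) = 1 := by
    rw [mistakes_eq_erase hE, Finset.erase_insert (by simpa using hjk), Finset.card_singleton]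
  have hmistk : #(mistakes vhat v k) = 1 := by
    rw [mistakes_eq_erase hE, Finset.pair_comm,
      Finset.erase_insert (by simpa using hjk.symm), Finset.card_singleton]
  have hsum := card_sdiff_mul_add_sum_le (S := S) (E := {j, k}) (C := 3 ^ n * (50 * (c : ℝ)))
    (x := fun i => 121 * (sampleTotal v i : ℝ))
    (w := fun i => (fTwoRule.totalPay 3 vhat v i : ℝ)) (fun i hi hiE => ?_) (fun i => ?_)
  · refine le_trans ?_ hsum
    rw [← Finset.mul_sum]
    have hV := sum_sampleTotal_ge hS h2
    have hP0 : (0 : ℝ) ≤ 3 ^ n * c := by positivity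
    -- If both mistakes are in `S`, then `#S ≥ 3` and the sampling revenue suffices because 121 * 3
    -- ≥ 2 * 171. Otherwise at most one bidder of `S` is lost, and 121 * 2 ≥ 171 is enough.
    by_cases hsub : {j, k} ⊆ S
    · have h3 : 3 ≤ #S := by
        by_contra h3
        have heq : ({j, k} : Finset (Fin n)) = S := by
          refine Finset.eq_of_subset_of_card_le hsub ?_
          rw [Finset.card_pair hjk]; omega
        refine hj ⟨k, hjk.symm, (hE k).1 (by simp), fun l hl => ?_⟩
        by_cases hlk : l = k
        · rw [hlk]
        · have hl : l ∉ S := by rw [← heq]; simp [hl, hlk]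
          exact (hS' l hl).trans (hS k (hsub (by simp)))
      have hcardE : (#(S \ {j, k}) : ℝ) + 2 = #S := by
        have := Finset.card_sdiff_add_card_eq_card hsub
        rw [Finset.card_pair hjk] at this
        exact_mod_cast this
      have h3' : (3 : ℝ) ≤ #S := by exact_mod_cast h3
      have h4 : 3 * (3 ^ n * (c : ℝ)) ≤ #S * (3 ^ n * (c : ℝ)) := by gcongr
      rw [← hcardE] at h4 hV ⊢
      nlinarith
    · have hcardE : (#S : ℝ) ≤ #(S \ {j, k}) + 1 := by
        have h1 := Finset.card_sdiff_add_card_inter S {j, k}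
        have h5 : #(S ∩ {j, k}) < 2 := by
          rw [← Finset.card_pair hjk]
          refine Finset.card_lt_card ⟨Finset.inter_subset_right, fun h => hsub ?_⟩
          exact fun i hi => Finset.mem_of_mem_inter_left (h hi)
        have : #S ≤ #(S \ {j, k}) + 1 := by omega
        exact_mod_cast this
      have h2' : (2 : ℝ) ≤ #S := by exact_mod_cast h2
      have h4 : 2 * (3 ^ n * (c : ℝ)) ≤ #S * (3 ^ n * (c : ℝ)) := by gcongr
      nlinarith
  · have h1 := fTwoRule_totalPay_ge_of_correct_of_two_le (hcorrect i hiE) (hmist i hiE)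
    have h6 : 3 ^ n * (50 * (c : ℝ)) ≤ 3 ^ n * (50 * v i) := by
      have : (c : ℝ) ≤ v i := by exact_mod_cast hS i hi
      gcongr
    have h7 : (0 : ℝ) ≤ sampleTotal v i := NNReal.coe_nonneg _
    linarith
  · have h7 : (0 : ℝ) ≤ sampleTotal v i := NNReal.coe_nonneg _
    by_cases hi : i ∈ ({j, k} : Finset (Fin n))
    · have h9 : 121 * (sampleTotal v i : ℝ) ≤ 3 ^ n * (50 * (postedPay (vickPrice v i) (v i) : ℝ)) +
          121 * sampleTotal v i := le_add_of_nonneg_left (by positivity)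
      rcases Finset.mem_insert.1 hi with rfl | hi
      · exact h9.trans (fTwoRule_totalPay_ge_of_not_seesTop hmistj hj)
      · rw [Finset.mem_singleton] at hi
        subst hi
        exact h9.trans (fTwoRule_totalPay_ge_of_not_seesTop hmistk hk)
    · have h8 := fTwoRule_totalPay_ge_of_two_le (hmist i hi)
      linarith

theorem fTwoRule_revenue_ge (vhat : Fin n → ℝ≥0) (hS : ∀ i ∈ S, c ≤ v i)
    (hS' : ∀ i ∉ S, v i ≤ c) (h2 : 2 ≤ #S) :
    #S * (3 ^ n * (50 * (c : ℝ))) ≤ ∑ i, (fTwoRule.totalPay 3 vhat v i : ℝ) := by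
  classical
  obtain ⟨E, hE⟩ : ∃ E : Finset (Fin n), ∀ i, i ∈ E ↔ v i ≠ vhat i :=
    ⟨univ.filter fun i => v i ≠ vhat i, by simp⟩
  rcases le_or_gt #E 1 with h1 | h1
  · exact fTwoRule_revenue_ge_of_card_le_one hS hS' h2 hE h1
  rcases le_or_gt #E 2 with h3 | h3
  · obtain ⟨j, k, hjk, rfl⟩ := Finset.card_eq_two.1 (le_antisymm h3 h1)
    have hE' : ∀ i, i ∈ ({k, j} : Finset (Fin n)) ↔ v i ≠ vhat i := by
      rwa [Finset.pair_comm]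
    by_cases hj : SeesTop vhat v j <;> by_cases hk : SeesTop vhat v k
    · rcases le_total (v k) (v j) with hle | hle
      · exact fTwoRule_revenue_ge_of_seesTop_of_seesTop hS h2 hjk hE hk hj hle
      · exact fTwoRule_revenue_ge_of_seesTop_of_seesTop hS h2 hjk.symm hE' hj hk hle
    · exact fTwoRule_revenue_ge_of_seesTop_of_not_seesTop hS hS' h2 hjk.symm hE' hj hk
    · exact fTwoRule_revenue_ge_of_seesTop_of_not_seesTop hS hS' h2 hjk hE hk hj
    · exact fTwoRule_revenue_ge_of_not_seesTop_of_not_seesTop hS hS' h2 hjk hE hk hj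
  -- With three or more mistakes every bidder sees at least two, so sampling has its full weight 171
  -- everywhere.
  · have hV := sum_sampleTotal_ge hS h2
    rw [Finset.mul_sum] at hV
    refine le_trans (le_of_eq (by ring)) (hV.trans (Finset.sum_le_sum fun i _ => ?_))
    refine fTwoRule_totalPay_ge_of_two_le ?_
    rw [mistakes_eq_erase hE]
    have := Finset.pred_card_le_card_erase (s := E) (a := i)
    omega

end

theorem fTwoRule_isRobust : IsRobust (fTwoRule.mechanism 3).revenue 4.42 F2 := by
  intro n vhat v
  rw [MixRule.mechanism_revenue]
  rcases eq_or_ne (F2 n v) 0 with h0 | h0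
  · rw [h0, NNReal.coe_zero, zero_div]
    positivity
  obtain ⟨S, c, h2, hS, hS', hF⟩ := exists_F2_eq v h0
  have h := fTwoRule_revenue_ge vhat hS hS' h2
  rw [hF, div_le_div_iff₀ (by norm_num) (by positivity)]
  push_cast
  nlinarith

/-- With `β = 1`, the factor two comes from `#S ≤ 2 (#S - 1)`, which is tight for `#S = 2`. -/
theorem fTwoRule_online_isRobust : IsRobust (fTwoRule.online 3).revenue (2 * 4.42) F2 := by
  refine MixRule.online_isRobust (β := 1) fTwoRule (by norm_num) (by norm_num)
    fTwoRule_isRobust (fun n v S c hS h2 => ?_) fun n v => ?_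
  · rw [one_mul]
    exact_mod_cast card_mul_le_F2 hS h2
  · rcases eq_or_ne (F2 n v) 0 with h0 | h0
    · exact ⟨∅, 0, by simp, by simp [h0]⟩
    · obtain ⟨S, c, h2, hS, -, hF⟩ := exists_F2_eq v h0
      refine ⟨S, c, hS, ?_⟩
      have h3 : (#S : ℝ≥0) ≤ 2 * (#S - 1 : ℕ) := by
        have : #S ≤ 2 * (#S - 1) := by omega
        exact_mod_cast this
      have h4 : F2 n v ≤ 2 * ((#S - 1 : ℕ) * c) := by
        rw [hF, ← mul_assoc]
        gcongr
      rw [one_mul]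
      exact_mod_cast h4

theorem exists_mechanism_F2 :
    ∃ (M : Mechanism) (hM : M.Truthful),
      IsConsistent M.revenue 1 OPT ∧ IsRobust M.revenue 4.42 F2 ∧
      (OSAP M hM).Truthful ∧ IsConsistent (OSAP M hM).revenue 1 OPT ∧
      IsRobust (OSAP M hM).revenue 8.84 F2 := by
  have hcons : ∀ n v i, fTwoRule.pred n v v i = 221 := by
    intro n v i
    simp [fTwoRule, mistakes_self]
  exact ⟨fTwoRule.mechanism 3, fTwoRule.mechanism_truthful, MixRule.mechanism_isConsistent hcons,
    fTwoRule_isRobust, OnlineMechanism.truthful _, MixRule.online_isConsistent hcons,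
    fTwoRule_online_isRobust.mono (by norm_num) (by norm_num)⟩

end CompetitiveAuction

end

theorem mainTheorem8 :
    (∃ (M : CompetitiveAuction.Mechanism) (hM : M.Truthful),
      CompetitiveAuction.IsConsistent M.revenue 1 CompetitiveAuction.OPT ∧
      CompetitiveAuction.IsRobust M.revenue 4.42 CompetitiveAuction.F2 ∧
      (CompetitiveAuction.OSAP M hM).Truthful ∧
      CompetitiveAuction.IsConsistent (CompetitiveAuction.OSAP M hM).revenue 1
        CompetitiveAuction.OPT ∧
      CompetitiveAuction.IsRobust (CompetitiveAuction.OSAP M hM).revenue 8.84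
        CompetitiveAuction.F2) ∧
    (∃ (M : CompetitiveAuction.Mechanism) (hM : M.Truthful),
      CompetitiveAuction.IsConsistent M.revenue 1 CompetitiveAuction.OPT ∧
      CompetitiveAuction.IsRobust M.revenue (Real.exp 1 + 1) CompetitiveAuction.maxV ∧
      (CompetitiveAuction.OSAP M hM).Truthful ∧
      CompetitiveAuction.IsConsistent (CompetitiveAuction.OSAP M hM).revenue 1
        CompetitiveAuction.OPT ∧
      CompetitiveAuction.IsRobust (CompetitiveAuction.OSAP M hM).revenue (2 * (Real.exp 1 + 1))
        CompetitiveAuction.maxV) :=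
  ⟨CompetitiveAuction.exists_mechanism_F2, CompetitiveAuction.exists_mechanism_maxV⟩
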